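/- Consider the problem of minimizing $f(x)$ subject to $Ax=b$, $x\in P$, where $A\in\mathbb{R}^{m\times n}$, $b\in\mathbb{R}^m$, and $P=\{x\in\mathbb{R}^n : \ell_i\le x_i\le u_i,\ i=1,\dots,n\}$ with real $\ell_i<u_i$ for all $i$. All norms are Euclidean. The KKT system for $(x,y,\mu,\nu)\in\mathbb{R}^n\times\mathbb{R}^m\times\mathbb{R}^n\times\mathbb{R}^n$ is $$\nabla f(x)+A^Ty-\mu+\nu=0,\quad Ax=b,\quad x\in P,\quad \mu\ge 0,\quad \nu\ge 0,\quad \mu_i(\ell_i-x_i)=0,\quad \nu_i(x_i-u_i)=0\ \text{ for all } i.$$ Let $X^*$ be the set of all $x$, and $W$ the set of all pairs $(x,y)$, that can be completed to a solution of this system. Assume: (a) the origin is in the relative interior of $AP-b=\{Ax-b : x\in P\}$; (b) strict complementarity: for every solution $(x,y,\mu,\nu)$ of the KKT system and every $i$, exactly one of $\mu_i$, $\ell_i-x_i$ is zero and exactly one of $\nu_i$, $x_i-u_i$ is zero; (c) $f$ is differentiable at every point of $P$, and $\|\nabla f(x)-\nabla f(x')\|\le L\|x-x'\|$ for all $x,x'\in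 P$, where $L>0$. Let $\gamma\in\mathbb{R}$ (possibly negative) be such that $\langle\nabla f(x)-\nabla f(x'),x-x'\rangle\ge\gamma\|x-x'\|^2$ for all $x,x'\in P$. Let $\Gamma>0$, $p>0$, $p>-\gamma$, let $\sigma$ be the largest singular value of $A$, put $L_K=L+p+\Gamma\sigma^2$, and let $0<c<1/L_K$. Let $$K(x,z;y)=f(x)+y^T(Ax-b)+\tfrac{\Gamma}{2}\|Ax-b\|^2+\tfrac p2\|x-z\|^2 ,$$ and let $[\cdot]_+$ be the projection onto $P$. Given $\alpha,\beta$ and initial points $x^0\in P$, $z^0\in P$, $y^0\in\mathbb{R}^m$, the smoothed proximal inexact augmented Lagrangian method generates, for $t=0,1,2,\dots$, $$y^{t+1}=y^t+\alpha(Ax^t-b),\qquad x^{t+1}=[x^t-c\nabla_xK(x^t,z^t;y^{t+1})]_+,\qquad z^{t+1}=z^t+\beta(x^{t+1}-z^t).$$ Then for all sufficiently small stepsizes, that is, there is $\alpha_0>0$ such that for every $\alpha\in(0,\alpha_0)$ there is $\beta_0\in(0,1]$ such that for every $\beta\in(0,\beta_0)$ and all initial points $x^0\in P$, $z^0\in P$,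 $y^0\in\mathbb{R}^m$, the following holds. The dual iterates $\{y^t\}$ are bounded; $X^*$ is nonempty; and, as $t\to\infty$, $$\|x^{t+1}-x^t\|\to 0,\quad \mathrm{dist}(x^t,X^*)\to 0,\quad \mathrm{dist}(z^t,X^*)\to 0,\quad \mathrm{dist}((x^t,y^t),W)\to 0,$$ and every limit point of the sequence $\{(x^t,y^t)\}$ belongs to $W$, i.e. is a primal-dual stationary (KKT) pair of the problem. -/

import Mathlib

open Filter Topology
open scoped Gradient InnerProductSpace

noncomputable section

/-- The data of the problem: minimize `f x` subject to `A x = b` and `lower ≤ x ≤ upper`,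
with `x ∈ ℝⁿ` and `A` a real `m × n` matrix. -/
structure BoxProblem (n m : ℕ) where
  f : EuclideanSpace ℝ (Fin n) → ℝ
  A : Matrix (Fin m) (Fin n) ℝ
  b : EuclideanSpace ℝ (Fin m)
  lower : Fin n → ℝ
  upper : Fin n → ℝ

namespace BoxProblem

variable {n m : ℕ}

/-- The box `P = {x | ℓᵢ ≤ xᵢ ≤ uᵢ for all i}`. -/
def box (Q : BoxProblem n m) : Set (EuclideanSpace ℝ (Fin n)) :=
  {x | ∀ i, Q.lower i ≤ x i ∧ x i ≤ Q.upper i}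

/-- The residual `A x - b` of the equality constraint. -/
def residual (Q : BoxProblem n m) (x : EuclideanSpace ℝ (Fin n)) :
    EuclideanSpace ℝ (Fin m) :=
  Q.A.toEuclideanLin x - Q.b

/-- The largest singular value `σ` of `A`: its operator norm for the Euclidean norms. -/
def sigma (Q : BoxProblem n m) : ℝ :=
  ‖Q.A.toEuclideanLin.toContinuousLinearMap‖

/-- The projection onto the box, coordinate by coordinate. -/
def proj (Q : BoxProblem n m) (x : EuclideanSpace ℝ (Fin n)) : EuclideanSpace ℝ (Fin n) :=
  WithLp.toLp 2 fun i => max (Q.lower i) (min (x i) (Q.upper i))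

/-- The KKT system at the point `x` with multipliers `y, μ, ν`. -/
structure IsKKT (Q : BoxProblem n m) (x : EuclideanSpace ℝ (Fin n))
    (y : EuclideanSpace ℝ (Fin m)) (μ ν : EuclideanSpace ℝ (Fin n)) : Prop where
  stationarity : ∇ Q.f x + Q.A.transpose.toEuclideanLin y - μ + ν = 0
  feasible : Q.A.toEuclideanLin x = Q.b
  mem_box : x ∈ Q.box
  mu_nonneg : ∀ i, 0 ≤ μ i
  nu_nonneg : ∀ i, 0 ≤ ν i
  compl_lower : ∀ i, μ i * (Q.lower i - x i) = 0
  compl_upper : ∀ i, ν i * (x i - Q.upper i) = 0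

/-- `X*`: the set of all `x` that are part of a solution of the KKT system. -/
def stationarySet (Q : BoxProblem n m) : Set (EuclideanSpace ℝ (Fin n)) :=
  {x | ∃ y μ ν, Q.IsKKT x y μ ν}

/-- `W`: the set of primal-dual stationary pairs `(x, y)`, in `ℝⁿ × ℝᵐ` with its
Euclidean metric. -/
def primalDualSet (Q : BoxProblem n m) :
    Set (WithLp 2 (EuclideanSpace ℝ (Fin n) × EuclideanSpace ℝ (Fin m))) :=
  {w | ∃ μ ν, Q.IsKKT w.fst w.snd μ ν}

/-- Strict complementarity: at every solution of the KKT system, for every `i`, exactly one of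
`μᵢ`, `ℓᵢ - xᵢ` is zero, and exactly one of `νᵢ`, `xᵢ - uᵢ` is zero. -/
def StrictComplementarity (Q : BoxProblem n m) : Prop :=
  ∀ x y μ ν, Q.IsKKT x y μ ν → ∀ i,
    Xor (μ i = 0) (Q.lower i - x i = 0) ∧ Xor (ν i = 0) (x i - Q.upper i = 0)

/-- The augmented Lagrangian `L(x; y) = f(x) + yᵀ(Ax - b) + (Γ/2) ‖Ax - b‖²`. -/
def augLagrangian (Q : BoxProblem n m) (Γ : ℝ) (x : EuclideanSpace ℝ (Fin n))
    (y : EuclideanSpace ℝ (Fin m)) : ℝ :=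
  Q.f x + ⟪y, Q.residual x⟫_ℝ + Γ / 2 * ‖Q.residual x‖ ^ 2

/-- The proximal augmented Lagrangian `K(x, z; y) = L(x; y) + (p/2) ‖x - z‖²`. -/
def proxLagrangian (Q : BoxProblem n m) (Γ p : ℝ) (x z : EuclideanSpace ℝ (Fin n))
    (y : EuclideanSpace ℝ (Fin m)) : ℝ :=
  Q.augLagrangian Γ x y + p / 2 * ‖x - z‖ ^ 2

/-- `x, y, z` are the sequences generated by the smoothed proximal inexact augmented Lagrangian
method with parameters `Γ, p, c, α, β`, started at some `x⁰ ∈ P`, `z⁰ ∈ P`, `y⁰ ∈ ℝᵐ`. -/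
structure IsProximalALMRun (Q : BoxProblem n m) (Γ p c α β : ℝ)
    (x : ℕ → EuclideanSpace ℝ (Fin n)) (y : ℕ → EuclideanSpace ℝ (Fin m))
    (z : ℕ → EuclideanSpace ℝ (Fin n)) : Prop where
  x_zero : x 0 ∈ Q.box
  z_zero : z 0 ∈ Q.box
  y_step : ∀ t, y (t + 1) = y t + α • Q.residual (x t)
  x_step : ∀ t, x (t + 1) =
    Q.proj (x t - c • ∇ (fun w => Q.proxLagrangian Γ p w (z t) (y (t + 1))) (x t))
  z_step : ∀ t, z (t + 1) = z t + β • (x (t + 1) - z t)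

end BoxProblem

end

/-!
Convergence rests on a potential function. For the proximal Lagrangian `K(x, z; y)` let
`d(y, z)` be its minimum over the box and `M(z)` the optimal value of
`f(x) + (p/2) ‖x - z‖²` over the box under `Ax = b`. A step of the method decreases
`K(x, z; y) - 2 d(y, z) + 2 M(z)` (`BoxProblem.IsRegular.potential_decrease`) by a positive multiple
of `‖x' - x‖²`, of the squared distance of the new iterate to the proximal center, and of the
squared residual at the minimizer of `K`. The terms of the wrong sign are controlled by the distance
between the minimizers that define `d(y, z)` and `M(z)`, hence by a *dual error bound*: this distance
is at most a constant times the residual `‖Ax - b‖` of the former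
(`BoxProblem.IsRegular.exists_dual_error_bound`).

The dual error bound holds globally, uniformly in `y` and `z`. Scale the residual linearly down to
zero and follow the minimizers of the strongly convex problem with the perturbed constraint
`Ax = b + r`. Nearby on this curve the active set can only shrink, so the multipliers of a nearby
point satisfy, up to a change of the right-hand side, the linear inequalities that describe the
multipliers of the given point. Hoffman's bound (`exists_hoffman_bound`) then provides multipliers
whose difference is at most a constant times the distance of the points, and strong monotonicity
gives a local Lipschitz estimate with a uniform constant, which integrates along the curve. Large
residuals are trivial since the box is bounded. The multipliers on the curve exist by a quadratic
penalty argument, because `AP - b` contains a ball of the range of `A`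
(`BoxProblem.IsRegular.exists_isProxStationary`).

The potential is bounded from below by `min f`, so the decrements tend to zero; boundedness from above
bounds `d(y, z)` from below, and the same ball in `AP - b` turns this into a bound on `y`. Limit
points are fixed points of the projected gradient step, that is KKT pairs, and compactness gives the
statements about distances.
-/

/-! ### Hoffman's error bound -/

section Hoffman

variable {F : Type*} [NormedAddCommGroup F] [InnerProductSpace ℝ F] [FiniteDimensional ℝ F]
  {ι : Type*}

/-- In the polar of a polyhedral cone `{d | ⟪aᵢ, d⟫ ≤ 0}` the norm is controlled by the positive
parts of the `⟪aᵢ, w⟫`: a unit vector of the polar at which all of them vanish would lie in the cone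
as well, hence be orthogonal to itself, and the polar meets the unit sphere in a compact set. -/
lemma exists_norm_le_of_mem_polar (a : ι → F) (J : Finset ι) :
    ∃ C : ℝ, 0 ≤ C ∧ ∀ w : F, (∀ d, (∀ i ∈ J, ⟪a i, d⟫_ℝ ≤ 0) → ⟪w, d⟫_ℝ ≤ 0) →
      ∀ V : ℝ, 0 ≤ V → (∀ i ∈ J, ⟪a i, w⟫_ℝ ≤ V) → ‖w‖ ≤ C * V := by
  set K : Set F := {w | ∀ d, (∀ i ∈ J, ⟪a i, d⟫_ℝ ≤ 0) → ⟪w, d⟫_ℝ ≤ 0} with hK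
  have hKc : IsClosed K := by
    simp only [hK, Set.ofPred_forall]
    refine isClosed_iInter fun d => isClosed_iInter fun _ => isClosed_le (by fun_prop) (by fun_prop)
  have hcomp : IsCompact (Metric.sphere (0 : F) 1 ∩ K) := (isCompact_sphere 0 1).inter_right hKc
  obtain ⟨ε, hε, hmin⟩ := hcomp.exists_forall_le' (f := fun w => ∑ i ∈ J, max 0 ⟪a i, w⟫_ℝ) (a := 0)
    (by fun_prop) (by
      rintro w ⟨hw1, hwK⟩
      by_contra hle
      have h0 : ∑ i ∈ J, max 0 ⟪a i, w⟫_ℝ = 0 :=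
        le_antisymm (not_lt.mp hle) (Finset.sum_nonneg fun i _ => le_max_left _ _)
      rw [Finset.sum_eq_zero_iff_of_nonneg fun i _ => le_max_left _ _] at h0
      have := hwK w fun i hi => (le_max_right _ _).trans (h0 i hi).le
      rw [real_inner_self_eq_norm_sq, mem_sphere_zero_iff_norm.mp hw1] at this
      norm_num at this)
  refine ⟨J.card / ε, by positivity, fun w hw V hV hwV => ?_⟩
  rcases eq_or_ne w 0 with rfl | hw0
  · simp; positivity
  have hpos : 0 < ‖w‖ := norm_pos_iff.mpr hw0
  have hmem : ‖w‖⁻¹ • w ∈ Metric.sphere (0 : F) 1 ∩ K := by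
    refine ⟨by simp [norm_smul, hpos.ne'], fun d hd => ?_⟩
    rw [real_inner_smul_left]
    exact mul_nonpos_of_nonneg_of_nonpos (by positivity) (hw d hd)
  have h1 : ε ≤ ∑ i ∈ J, ‖w‖⁻¹ * V := (hmin _ hmem).trans <| Finset.sum_le_sum fun i hi => by
    rw [real_inner_smul_right]
    exact max_le (by positivity) (mul_le_mul_of_nonneg_left (hwV i hi) (by positivity))
  rw [Finset.sum_const, nsmul_eq_mul] at h1
  rw [div_mul_eq_mul_div, le_div_iff₀ hε]
  calc ‖w‖ * ε ≤ ‖w‖ * (J.card * (‖w‖⁻¹ * V)) := by gcongr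
    _ = J.card * V := by field_simp

/-- **Hoffman's error bound**: the distance of a point to a nonempty polyhedron
`{y | ⟪aᵢ, y⟫ ≤ cᵢ, i ∈ J}` is at most a constant times the largest violation `V`, with a constant
that depends neither on the right-hand sides `c` nor on the set `J` of constraints in force. -/
lemma exists_hoffman_bound [Finite ι] (a : ι → F) :
    ∃ C : ℝ, 0 ≤ C ∧ ∀ (J : Set ι) (c : ι → ℝ) (y : F), (∃ y', ∀ i ∈ J, ⟪a i, y'⟫_ℝ ≤ c i) →
      ∀ V : ℝ, 0 ≤ V → (∀ i ∈ J, ⟪a i, y⟫_ℝ ≤ c i + V) →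
      ∃ y', (∀ i ∈ J, ⟪a i, y'⟫_ℝ ≤ c i) ∧ ‖y - y'‖ ≤ C * V := by
  classical
  have := Fintype.ofFinite ι
  choose C hC0 hC using exists_norm_le_of_mem_polar a
  refine ⟨∑ J : Finset ι, C J, Finset.sum_nonneg fun J _ => hC0 J, fun J c y hne V hV hy => ?_⟩
  set S : Set F := {y' | ∀ i ∈ J, ⟪a i, y'⟫_ℝ ≤ c i} with hS
  have hSc : IsClosed S := by
    simp only [hS, Set.ofPred_forall]
    exact isClosed_iInter fun i => isClosed_iInter fun _ => isClosed_le (by fun_prop) (by fun_prop)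
  have hSconv : Convex ℝ S := by
    intro u hu v hv s t hs ht hst i hi
    rw [inner_add_right, real_inner_smul_right, real_inner_smul_right]
    calc s * ⟪a i, u⟫_ℝ + t * ⟪a i, v⟫_ℝ ≤ s * c i + t * c i := by
          gcongr
          exacts [hu i hi, hv i hi]
      _ = c i := by rw [← add_mul, hst, one_mul]
  have hne' : S.Nonempty := hne
  obtain ⟨q, hqS, hq⟩ := exists_norm_eq_iInf_of_complete_convex hne' hSc.isComplete hSconv y
  rw [norm_eq_iInf_iff_real_inner_le_zero hSconv hqS] at hq
  refine ⟨q, hqS, ?_⟩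
  set I : Finset ι := Finset.univ.filter fun i => i ∈ J ∧ ⟪a i, q⟫_ℝ = c i with hI
  -- a direction that keeps the active constraints can be followed a little inside the polyhedron
  have hpolar : ∀ d, (∀ i ∈ I, ⟪a i, d⟫_ℝ ≤ 0) → ⟪y - q, d⟫_ℝ ≤ 0 := by
    intro d hd
    have hev : ∀ᶠ t : ℝ in 𝓝[>] 0, q + t • d ∈ S := by
      simp only [hS, Set.mem_ofPred_eq]
      refine Filter.eventually_all.mpr fun i => ?_
      by_cases hiJ : i ∈ J
      swap
      · exact Eventually.of_forall fun t h => absurd h hiJ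
      rcases (hqS i hiJ).eq_or_lt with heq | hlt
      · filter_upwards [self_mem_nhdsWithin] with t ht _
        rw [inner_add_right, real_inner_smul_right, heq]
        have := hd i (by simp [hI, hiJ, heq])
        nlinarith [Set.mem_Ioi.mp ht]
      · have hcont : ContinuousAt (fun t : ℝ => ⟪a i, q + t • d⟫_ℝ) 0 := by fun_prop
        have : ∀ᶠ t : ℝ in 𝓝 0, ⟪a i, q + t • d⟫_ℝ < c i :=
          hcont.eventually_lt continuousAt_const (by simpa using hlt)
        filter_upwards [nhdsWithin_le_nhds this] with t ht _ using ht.le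
    obtain ⟨t, htS, ht⟩ := (hev.and self_mem_nhdsWithin).exists
    have := hq _ htS
    rw [add_sub_cancel_left, real_inner_smul_right] at this
    exact nonpos_of_mul_nonpos_right this ht
  refine (hC I (y - q) hpolar V hV fun i hi => ?_).trans ?_
  · simp only [hI, Finset.mem_filter, Finset.mem_univ, true_and] at hi
    rw [inner_sub_right, hi.2]
    linarith [hy i hi.1]
  · gcongr
    exact Finset.single_le_sum (f := C) (fun J _ => hC0 J) (Finset.mem_univ I)

end Hoffman

/-! ### Calculus on convex sets -/

section Calculus

variable {E : Type*} [NormedAddCommGroup E]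

/-- A continuous curve on `[0, 1]` that moves locally to the right of each point with speed at most
`C` moves by at most `C`. -/
lemma norm_sub_le_of_eventually_norm_sub_le {x : ℝ → E} {C : ℝ}
    (hx : ContinuousOn x (Set.Icc 0 1))
    (h : ∀ s ∈ Set.Ico (0 : ℝ) 1, ∀ᶠ t in 𝓝[>] s, ‖x t - x s‖ ≤ C * (t - s)) :
    ‖x 1 - x 0‖ ≤ C := by
  have key := image_le_of_liminf_slope_right_le_deriv_boundary (f := fun s => ‖x s - x 0‖)
    (a := 0) (b := 1) (B := fun s => C * s) (B' := fun _ => C)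
    (hx.sub continuousOn_const).norm (by simp) (by fun_prop)
    (fun s _ => by simpa using ((hasDerivAt_id s).const_mul C).hasDerivWithinAt) ?_
    (Set.right_mem_Icc.mpr zero_le_one)
  · simpa using key
  · intro s hs r hr
    refine Eventually.frequently ?_
    filter_upwards [h s hs, self_mem_nhdsWithin] with t ht hst
    have hpos : 0 < t - s := sub_pos.mpr hst
    rw [slope_def_field, div_lt_iff₀ hpos]
    have := norm_sub_norm_le (x t - x 0) (x s - x 0)
    rw [sub_sub_sub_cancel_right] at this
    nlinarith

variable [InnerProductSpace ℝ E] [CompleteSpace E]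

lemma inner_gradient_nonneg_of_isMinOn {h : E → ℝ} {g x : E} {s : Set E} (hs : Convex ℝ s)
    (hx : x ∈ s) (hmin : IsMinOn h s x) (hg : HasGradientAt h g x) {w : E} (hw : w ∈ s) :
    0 ≤ ⟪g, w - x⟫_ℝ := by
  have := hmin.localize.hasFDerivWithinAt_nonneg hg.hasFDerivAt.hasFDerivWithinAt
    (sub_mem_posTangentConeAt_of_segment_subset (hs.segment_subset hx hw))
  simpa using this

/-- The descent lemma on a convex set. -/
lemma le_add_inner_gradient_of_lipschitz {f : E → ℝ} {s : Set E} (hs : Convex ℝ s) {L : ℝ}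
    (hdiff : ∀ x ∈ s, DifferentiableAt ℝ f x)
    (hlip : ∀ x ∈ s, ∀ x' ∈ s, ‖∇ f x - ∇ f x'‖ ≤ L * ‖x - x'‖) {x w : E} (hx : x ∈ s)
    (hw : w ∈ s) : f w ≤ f x + ⟪∇ f x, w - x⟫_ℝ + L / 2 * ‖w - x‖ ^ 2 := by
  have hmem : ∀ t ∈ Set.Icc (0 : ℝ) 1, x + t • (w - x) ∈ s := fun t ht =>
    hs.add_smul_sub_mem hx hw ht
  have hder : ∀ t ∈ Set.Icc (0 : ℝ) 1,
      HasDerivAt (fun t : ℝ => f (x + t • (w - x))) ⟪∇ f (x + t • (w - x)), w - x⟫_ℝ t := by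
    intro t ht
    have h1 := (hdiff _ (hmem t ht)).hasGradientAt.hasFDerivAt
    have h2 : HasDerivAt (fun t : ℝ => x + t • (w - x)) (w - x) t := by
      simpa using ((hasDerivAt_id t).smul_const (w - x)).const_add x
    refine HasDerivAt.congr_deriv (h1.comp_hasDerivAt t h2 :) ?_
    simp
  have key := image_le_of_deriv_right_le_deriv_boundary
    (f := fun t : ℝ => f (x + t • (w - x))) (a := 0) (b := 1)
    (f' := fun t => ⟪∇ f (x + t • (w - x)), w - x⟫_ℝ)
    (B := fun t => f x + t * ⟪∇ f x, w - x⟫_ℝ + L / 2 * ‖w - x‖ ^ 2 * t ^ 2)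
    (B' := fun t => ⟪∇ f x, w - x⟫_ℝ + L * ‖w - x‖ ^ 2 * t)
    (fun t ht => (hder t ht).continuousAt.continuousWithinAt)
    (fun t ht => (hder t (Set.Ico_subset_Icc_self ht)).hasDerivWithinAt) (by simp) (by fun_prop)
    (fun t _ => ?_) ?_ (Set.right_mem_Icc.mpr zero_le_one)
  · simpa using key
  · have h1 := (((hasDerivAt_id t).mul_const ⟪∇ f x, w - x⟫_ℝ).const_add (f x)).add
      ((hasDerivAt_pow 2 t).const_mul (L / 2 * ‖w - x‖ ^ 2))
    refine (h1.congr_deriv ?_).hasDerivWithinAt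
    simp; ring
  · intro t ht
    have h1 := hlip _ (hmem t (Set.Ico_subset_Icc_self ht)) _ hx
    rw [add_sub_cancel_left, norm_smul, Real.norm_of_nonneg ht.1] at h1
    have h2 := (real_inner_le_norm (∇ f (x + t • (w - x)) - ∇ f x) (w - x)).trans
      (mul_le_mul_of_nonneg_right h1 (norm_nonneg _))
    rw [inner_sub_left] at h2
    linarith [h2]

end Calculus

namespace BoxProblem

variable {n m : ℕ} {Q : BoxProblem n m}

/-! ### The box and the constraint map -/

lemma mem_box {x : EuclideanSpace ℝ (Fin n)} :
    x ∈ Q.box ↔ ∀ i, Q.lower i ≤ x i ∧ x i ≤ Q.upper i := Iff.rfl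

lemma convex_box : Convex ℝ Q.box := by
  intro u hu v hv s t hs ht hst i
  have h1 := hu i
  have h2 := hv i
  simp only [PiLp.add_apply, PiLp.smul_apply, smul_eq_mul]
  constructor
  · calc Q.lower i = s * Q.lower i + t * Q.lower i := by rw [← add_mul, hst, one_mul]
      _ ≤ _ := by gcongr; exacts [h1.1, h2.1]
  · calc s * u i + t * v i ≤ s * Q.upper i + t * Q.upper i := by gcongr; exacts [h1.2, h2.2]
      _ = _ := by rw [← add_mul, hst, one_mul]

lemma isCompact_box : IsCompact Q.box := by
  have h : Q.box = (EuclideanSpace.equiv (Fin n) ℝ) ⁻¹' Set.Icc Q.lower Q.upper := by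
    ext x
    simp [mem_box, Pi.le_def, forall_and]
  rw [h]
  exact (EuclideanSpace.equiv (Fin n) ℝ).toHomeomorph.isCompact_preimage.mpr isCompact_Icc

lemma proj_mem_box (h : ∀ i, Q.lower i < Q.upper i) (u : EuclideanSpace ℝ (Fin n)) :
    Q.proj u ∈ Q.box := fun i =>
  ⟨le_max_left _ _, max_le (h i).le (min_le_right _ _)⟩

/-- The obtuse angle property of the projection onto the box. -/
lemma inner_proj_sub_nonneg (h : ∀ i, Q.lower i < Q.upper i) (u : EuclideanSpace ℝ (Fin n))
    {w : EuclideanSpace ℝ (Fin n)} (hw : w ∈ Q.box) :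
    0 ≤ ⟪Q.proj u - u, w - Q.proj u⟫_ℝ := by
  rw [PiLp.inner_apply]
  refine Finset.sum_nonneg fun i _ => ?_
  have hi := hw i
  have hlu := h i
  simp only [proj, PiLp.sub_apply, RCLike.inner_apply, conj_trivial]
  rcases le_total (u i) (Q.upper i) with h1 | h1
  · rw [min_eq_left h1]
    rcases le_total (Q.lower i) (u i) with h2 | h2
    · rw [max_eq_right h2]; simp
    · rw [max_eq_left h2]
      exact mul_nonneg (by linarith) (by linarith)
  · rw [min_eq_right h1, max_eq_right hlu.le]
    exact mul_nonneg_of_nonpos_of_nonpos (by linarith) (by linarith)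

lemma continuous_proj : Continuous Q.proj := by
  unfold proj
  fun_prop

lemma exists_norm_sub_le_of_mem_box :
    ∃ D : ℝ, 0 ≤ D ∧ ∀ x ∈ Q.box, ∀ x' ∈ Q.box, ‖x - x'‖ ≤ D := by
  obtain ⟨D, hD⟩ := Metric.isBounded_iff.mp (isCompact_box (Q := Q)).isBounded
  exact ⟨max D 0, le_max_right _ _, fun x hx x' hx' =>
    (dist_eq_norm x x' ▸ hD hx hx').trans (le_max_left _ _)⟩

/-- The variational inequality of a vector `g` over the box is a system of sign conditions. -/
lemma forall_inner_sub_nonneg_iff {g x : EuclideanSpace ℝ (Fin n)} (hx : x ∈ Q.box) :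
    (∀ w ∈ Q.box, 0 ≤ ⟪g, w - x⟫_ℝ) ↔
      ∀ i, (Q.lower i < x i → g i ≤ 0) ∧ (x i < Q.upper i → 0 ≤ g i) := by
  classical
  constructor
  · intro h i
    -- move only the `i`-th coordinate of `x`
    have key : ∀ s, Q.lower i ≤ s → s ≤ Q.upper i → 0 ≤ g i * (s - x i) := by
      intro s hs1 hs2
      have h1 := h (x + EuclideanSpace.single i (s - x i)) (by
        intro j
        by_cases hj : j = i
        · subst hj; simpa using ⟨hs1, hs2⟩
        · simpa [hj] using hx j)
      rw [add_sub_cancel_left, EuclideanSpace.inner_single_right] at h1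
      simpa [mul_comm] using h1
    constructor
    · intro hl
      have := key _ le_rfl ((hx i).1.trans (hx i).2)
      nlinarith
    · intro hu
      have := key _ ((hx i).1.trans (hx i).2) le_rfl
      nlinarith
  · intro h w hw
    rw [PiLp.inner_apply]
    refine Finset.sum_nonneg fun i _ => ?_
    simp only [PiLp.sub_apply, RCLike.inner_apply, conj_trivial]
    rcases le_total (w i) (x i) with h1 | h1
    · rcases h1.eq_or_lt with h2 | h2
      · simp [h2]
      · exact mul_nonneg_of_nonpos_of_nonpos (by linarith) ((h i).1 ((hw i).1.trans_lt h2))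
    · rcases h1.eq_or_lt with h2 | h2
      · simp [h2]
      · exact mul_nonneg (by linarith) ((h i).2 (h2.trans_le (hw i).2))

lemma inner_transpose (y : EuclideanSpace ℝ (Fin m)) (w : EuclideanSpace ℝ (Fin n)) :
    ⟪Q.A.transpose.toEuclideanLin y, w⟫_ℝ = ⟪y, Q.A.toEuclideanLin w⟫_ℝ := by
  rw [← Matrix.conjTranspose_eq_transpose_of_trivial, Matrix.toEuclideanLin_conjTranspose_eq_adjoint,
    LinearMap.adjoint_inner_left]

lemma sigma_nonneg : 0 ≤ Q.sigma := norm_nonneg _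

lemma norm_map_le (w : EuclideanSpace ℝ (Fin n)) : ‖Q.A.toEuclideanLin w‖ ≤ Q.sigma * ‖w‖ :=
  Q.A.toEuclideanLin.toContinuousLinearMap.le_opNorm w

lemma norm_transpose_le (y : EuclideanSpace ℝ (Fin m)) :
    ‖Q.A.transpose.toEuclideanLin y‖ ≤ Q.sigma * ‖y‖ := by
  set u := Q.A.transpose.toEuclideanLin y with hu
  rcases (norm_nonneg u).eq_or_lt with h | h
  · rw [← h]; exact mul_nonneg sigma_nonneg (norm_nonneg _)
  · have h1 : ‖u‖ * ‖u‖ ≤ ‖y‖ * (Q.sigma * ‖u‖) := by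
      rw [← real_inner_self_eq_norm_mul_norm]
      nth_rewrite 1 [hu]
      rw [inner_transpose]
      exact (real_inner_le_norm _ _).trans (mul_le_mul_of_nonneg_left (norm_map_le u) (norm_nonneg _))
    nlinarith

lemma residual_sub (x x' : EuclideanSpace ℝ (Fin n)) :
    Q.residual x - Q.residual x' = Q.A.toEuclideanLin (x - x') := by
  simp [residual]

lemma continuous_map : Continuous fun x => Q.A.toEuclideanLin x :=
  Q.A.toEuclideanLin.continuous_of_finiteDimensional

lemma continuous_transpose : Continuous fun y => Q.A.transpose.toEuclideanLin y :=
  Q.A.transpose.toEuclideanLin.continuous_of_finiteDimensional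

@[fun_prop]
lemma continuous_residual : Continuous Q.residual := continuous_map.sub continuous_const

/-! ### The gradient field of the proximal Lagrangian -/

/-- The gradient in `x` of `f(x) + yᵀ(Ax - b) + (p/2) ‖x - z‖²`. -/
noncomputable def proxField (Q : BoxProblem n m) (p : ℝ) (z x : EuclideanSpace ℝ (Fin n))
    (y : EuclideanSpace ℝ (Fin m)) : EuclideanSpace ℝ (Fin n) :=
  ∇ Q.f x + p • (x - z) + Q.A.transpose.toEuclideanLin y

/-- `x` solves the variational inequality of the field `proxField` over the box: it is stationary
for `f(x) + yᵀ(Ax - b) + (p/2) ‖x - z‖²` on the box. -/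
def IsProxStationary (Q : BoxProblem n m) (p : ℝ) (z x : EuclideanSpace ℝ (Fin n))
    (y : EuclideanSpace ℝ (Fin m)) : Prop :=
  x ∈ Q.box ∧ ∀ w ∈ Q.box, 0 ≤ ⟪Q.proxField p z x y, w - x⟫_ℝ

/-- The regularity of the objective on the box: differentiability, a gradient that is Lipschitz
with constant `L`, and the (possibly negative) monotonicity constant `γ`. -/
structure IsRegular (Q : BoxProblem n m) (L γ : ℝ) : Prop where
  diff : ∀ x ∈ Q.box, DifferentiableAt ℝ Q.f x
  lip : ∀ x ∈ Q.box, ∀ x' ∈ Q.box, ‖∇ Q.f x - ∇ Q.f x'‖ ≤ L * ‖x - x'‖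
  mono : ∀ x ∈ Q.box, ∀ x' ∈ Q.box, γ * ‖x - x'‖ ^ 2 ≤ ⟪∇ Q.f x - ∇ Q.f x', x - x'⟫_ℝ

lemma hasGradientAt_residual_terms (x : EuclideanSpace ℝ (Fin n)) (d : EuclideanSpace ℝ (Fin m))
    (y : EuclideanSpace ℝ (Fin m)) (z : EuclideanSpace ℝ (Fin n)) (Γ p : ℝ) :
    HasGradientAt (fun w => ⟪y, Q.residual w - d⟫_ℝ + Γ / 2 * ‖Q.residual w - d‖ ^ 2
        + p / 2 * ‖w - z‖ ^ 2)
      (p • (x - z) + Q.A.transpose.toEuclideanLin (y + Γ • (Q.residual x - d))) x := by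
  rw [hasGradientAt_iff_hasFDerivAt]
  have hA : HasFDerivAt (fun w => Q.residual w - d)
      Q.A.toEuclideanLin.toContinuousLinearMap x :=
    (Q.A.toEuclideanLin.toContinuousLinearMap.hasFDerivAt.sub_const Q.b).sub_const d
  have hz : HasFDerivAt (fun w => w - z) (ContinuousLinearMap.id ℝ _) x :=
    (hasFDerivAt_id x).sub_const z
  have h := (((hasFDerivAt_const y x).inner ℝ hA).add (hA.norm_sq.const_mul (Γ / 2))).add
    (hz.norm_sq.const_mul (p / 2))
  refine h.congr_fderiv ?_
  ext w
  simp [inner_transpose]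
  ring

lemma IsRegular.hasGradientAt_proxLagrangian {L γ : ℝ} (hQ : Q.IsRegular L γ) (Γ p : ℝ)
    {x : EuclideanSpace ℝ (Fin n)} (hx : x ∈ Q.box) (z : EuclideanSpace ℝ (Fin n))
    (y : EuclideanSpace ℝ (Fin m)) :
    HasGradientAt (fun w => Q.proxLagrangian Γ p w z y)
      (Q.proxField p z x (y + Γ • Q.residual x)) x := by
  have h1 := (hQ.diff x hx).hasGradientAt
  have h2 := hasGradientAt_residual_terms (Q := Q) x 0 y z Γ p
  rw [hasGradientAt_iff_hasFDerivAt] at h1 h2 ⊢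
  refine ((h1.add h2).congr_fderiv ?_).congr_of_eventuallyEq (Eventually.of_forall fun w => ?_)
  · rw [← map_add, proxField, sub_zero, add_assoc]
  · simp [proxLagrangian, augLagrangian, add_assoc]

lemma IsRegular.continuousOn_f {L γ : ℝ} (hQ : Q.IsRegular L γ) : ContinuousOn Q.f Q.box :=
  fun x hx => (hQ.diff x hx).continuousAt.continuousWithinAt

lemma IsRegular.continuousOn_gradient {L γ : ℝ} (hQ : Q.IsRegular L γ) :
    ContinuousOn (∇ Q.f) Q.box := by
  refine (LipschitzOnWith.of_dist_le_mul (K := L.toNNReal) fun x hx x' hx' => ?_).continuousOn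
  rw [dist_eq_norm, dist_eq_norm]
  exact (hQ.lip x hx x' hx').trans
    (mul_le_mul_of_nonneg_right (Real.le_coe_toNNReal L) (norm_nonneg _))

/-- Strong monotonicity of the gradient of the augmented proximal Lagrangian; `Γ = 0` is the case
without the penalty term. -/
lemma IsRegular.le_inner_proxField_sub {L γ : ℝ} (hQ : Q.IsRegular L γ) {Γ : ℝ} (hΓ : 0 ≤ Γ) (p : ℝ)
    {x x' : EuclideanSpace ℝ (Fin n)} (hx : x ∈ Q.box) (hx' : x' ∈ Q.box)
    (z : EuclideanSpace ℝ (Fin n)) (y : EuclideanSpace ℝ (Fin m)) :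
    (p + γ) * ‖x - x'‖ ^ 2 ≤
      ⟪Q.proxField p z x (y + Γ • Q.residual x) - Q.proxField p z x' (y + Γ • Q.residual x'),
        x - x'⟫_ℝ := by
  have h : Q.proxField p z x (y + Γ • Q.residual x) - Q.proxField p z x' (y + Γ • Q.residual x')
      = (∇ Q.f x - ∇ Q.f x') + p • (x - x')
        + Γ • Q.A.transpose.toEuclideanLin (Q.A.toEuclideanLin (x - x')) := by
    rw [← residual_sub]
    simp only [proxField, map_add, map_sub, map_smul]
    module
  rw [h, inner_add_left, inner_add_left, real_inner_smul_left, real_inner_smul_left,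
    real_inner_self_eq_norm_sq, inner_transpose, real_inner_self_eq_norm_sq]
  have := hQ.mono x hx x' hx'
  nlinarith [mul_nonneg hΓ (sq_nonneg ‖Q.A.toEuclideanLin (x - x')‖)]

lemma IsRegular.norm_proxField_sub_le {L γ : ℝ} (hQ : Q.IsRegular L γ) {Γ p : ℝ} (hΓ : 0 ≤ Γ)
    (hp : 0 ≤ p) {x x' : EuclideanSpace ℝ (Fin n)} (hx : x ∈ Q.box) (hx' : x' ∈ Q.box)
    (z : EuclideanSpace ℝ (Fin n)) (y : EuclideanSpace ℝ (Fin m)) :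
    ‖Q.proxField p z x (y + Γ • Q.residual x) - Q.proxField p z x' (y + Γ • Q.residual x')‖ ≤
      (L + p + Γ * Q.sigma ^ 2) * ‖x - x'‖ := by
  have h : Q.proxField p z x (y + Γ • Q.residual x) - Q.proxField p z x' (y + Γ • Q.residual x')
      = (∇ Q.f x - ∇ Q.f x') + p • (x - x')
        + Γ • Q.A.transpose.toEuclideanLin (Q.A.toEuclideanLin (x - x')) := by
    rw [← residual_sub]
    simp only [proxField, map_add, map_sub, map_smul]
    module
  rw [h]
  refine (norm_add₃_le).trans ?_
  rw [norm_smul, norm_smul, Real.norm_of_nonneg hp, Real.norm_of_nonneg hΓ]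
  have h1 := hQ.lip x hx x' hx'
  have h2 : ‖Q.A.transpose.toEuclideanLin (Q.A.toEuclideanLin (x - x'))‖
      ≤ Q.sigma * (Q.sigma * ‖x - x'‖) :=
    (norm_transpose_le _).trans (mul_le_mul_of_nonneg_left (norm_map_le _) sigma_nonneg)
  nlinarith [mul_le_mul_of_nonneg_left h2 hΓ]

/-- Two stationary points for the same `z` differ by a quantity controlled by the pairing of the
differences of the multipliers and of the residuals. -/
lemma IsRegular.norm_sub_sq_le_of_isProxStationary {L γ : ℝ} (hQ : Q.IsRegular L γ) {p : ℝ}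
    {z x x' : EuclideanSpace ℝ (Fin n)} {y y' : EuclideanSpace ℝ (Fin m)}
    (h : Q.IsProxStationary p z x y) (h' : Q.IsProxStationary p z x' y') :
    (p + γ) * ‖x - x'‖ ^ 2 ≤ ⟪y' - y, Q.residual x - Q.residual x'⟫_ℝ := by
  have h1 := h.2 x' h'.1
  have h2 := h'.2 x h.1
  have h3 := hQ.le_inner_proxField_sub le_rfl p h.1 h'.1 z 0
  rw [residual_sub, ← inner_transpose]
  simp only [proxField, map_sub, map_zero, zero_smul, add_zero, inner_add_left,
    inner_sub_left, inner_sub_right] at h1 h2 h3 ⊢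
  linarith

/-- Passing to a point with a larger active set, a multiplier can be replaced by one of the new
point at a distance controlled by the change `v - v₀` of the data: for a fixed active set the
multipliers form a polyhedron whose right-hand side depends on `v`. -/
lemma exists_multiplier_near (Q : BoxProblem n m) :
    ∃ C : ℝ, 0 ≤ C ∧ ∀ (x₀ x v₀ v : EuclideanSpace ℝ (Fin n)) (y₀ y : EuclideanSpace ℝ (Fin m)),
      x₀ ∈ Q.box → x ∈ Q.box →
      (∀ i, Q.lower i < x₀ i → Q.lower i < x i) → (∀ i, x₀ i < Q.upper i → x i < Q.upper i) →
      (∀ w ∈ Q.box, 0 ≤ ⟪v₀ + Q.A.transpose.toEuclideanLin y₀, w - x₀⟫_ℝ) →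
      (∀ w ∈ Q.box, 0 ≤ ⟪v + Q.A.transpose.toEuclideanLin y, w - x⟫_ℝ) →
      ∃ y', (∀ w ∈ Q.box, 0 ≤ ⟪v₀ + Q.A.transpose.toEuclideanLin y', w - x₀⟫_ℝ) ∧
        ‖y - y'‖ ≤ C * ‖v - v₀‖ := by
  classical
  let e : Fin n → EuclideanSpace ℝ (Fin m) := fun i =>
    Q.A.toEuclideanLin (EuclideanSpace.single i 1)
  have he : ∀ i y, ⟪e i, y⟫_ℝ = Q.A.transpose.toEuclideanLin y i := by
    intro i y
    rw [real_inner_comm, ← inner_transpose, EuclideanSpace.inner_single_right]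
    simp
  obtain ⟨C, hC0, hC⟩ := exists_hoffman_bound (Sum.elim e fun i => -e i)
  refine ⟨C, hC0, fun x₀ x v₀ v y₀ y hx₀ hx hl hu h₀ h => ?_⟩
  rw [forall_inner_sub_nonneg_iff hx₀] at h₀
  rw [forall_inner_sub_nonneg_iff hx] at h
  simp only [PiLp.add_apply] at h h₀
  have habs : ∀ i, |v i - v₀ i| ≤ ‖v - v₀‖ := fun i => by
    simpa using PiLp.norm_apply_le (v - v₀) i
  set J : Set (Fin n ⊕ Fin n) :=
    {k | Sum.elim (fun i => Q.lower i < x₀ i) (fun i => x₀ i < Q.upper i) k} with hJ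
  have hne : ∀ k ∈ J, ⟪Sum.elim e (fun i => -e i) k, y₀⟫_ℝ
      ≤ Sum.elim (fun i => -v₀ i) (fun i => v₀ i) k := by
    rintro (i | i) hi
    · simp only [hJ, Set.mem_ofPred_eq, Sum.elim_inl, he] at hi ⊢
      linarith [(h₀ i).1 hi]
    · simp only [hJ, Set.mem_ofPred_eq, Sum.elim_inr, inner_neg_left, he] at hi ⊢
      linarith [(h₀ i).2 hi]
  have hviol : ∀ k ∈ J, ⟪Sum.elim e (fun i => -e i) k, y⟫_ℝ
      ≤ Sum.elim (fun i => -v₀ i) (fun i => v₀ i) k + ‖v - v₀‖ := by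
    rintro (i | i) hi
    · simp only [hJ, Set.mem_ofPred_eq, Sum.elim_inl, he] at hi ⊢
      linarith [(h i).1 (hl i hi), neg_abs_le (v i - v₀ i), habs i]
    · simp only [hJ, Set.mem_ofPred_eq, Sum.elim_inr, inner_neg_left, he] at hi ⊢
      linarith [(h i).2 (hu i hi), le_abs_self (v i - v₀ i), habs i]
  obtain ⟨y', hy', hd⟩ := hC J _ y ⟨y₀, hne⟩ ‖v - v₀‖ (norm_nonneg _) hviol
  refine ⟨y', ?_, hd⟩
  rw [forall_inner_sub_nonneg_iff hx₀]
  intro i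
  have h1 := hy' (Sum.inl i)
  have h2 := hy' (Sum.inr i)
  simp only [hJ, Set.mem_ofPred_eq, Sum.elim_inl, Sum.elim_inr, inner_neg_left, he] at h1 h2
  simp only [PiLp.add_apply]
  exact ⟨fun hi => by linarith [h1 hi], fun hi => by linarith [h2 hi]⟩

/-! ### Multipliers under the relative interior condition -/

lemma exists_residual_eq_of_mem_intrinsicInterior (hbox : ∀ i, Q.lower i < Q.upper i)
    (hint : (0 : EuclideanSpace ℝ (Fin m)) ∈ intrinsicInterior ℝ (Q.residual '' Q.box)) :
    ∃ δ : ℝ, 0 < δ ∧ ∀ v, ‖Q.A.toEuclideanLin v‖ ≤ δ →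
      ∃ x ∈ Q.box, Q.residual x = Q.A.toEuclideanLin v := by
  set S := Q.residual '' Q.box with hS
  have h0 : (0 : EuclideanSpace ℝ (Fin m)) ∈ affineSpan ℝ S :=
    subset_affineSpan ℝ S (intrinsicInterior_subset hint)
  -- the box has interior points, so the affine span of its image contains the range of `A`
  have hspan : ∀ v, Q.A.toEuclideanLin v ∈ affineSpan ℝ S := by
    intro v
    set x₀ : EuclideanSpace ℝ (Fin n) := WithLp.toLp 2 fun i => (Q.lower i + Q.upper i) / 2 with hx₀
    have hx₀i : ∀ i, x₀ i = (Q.lower i + Q.upper i) / 2 := fun i => rfl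
    have hev : ∀ᶠ t : ℝ in 𝓝[>] 0, x₀ + t • v ∈ Q.box := by
      simp only [mem_box]
      refine Filter.eventually_all.mpr fun i => nhdsWithin_le_nhds ?_
      have hc : ContinuousAt (fun t : ℝ => (x₀ + t • v) i) 0 := by
        simp only [PiLp.add_apply, PiLp.smul_apply]; fun_prop
      have := hbox i
      refine ((continuousAt_const.eventually_lt hc ?_).and
        (hc.eventually_lt continuousAt_const ?_)).mono fun t ht => ⟨ht.1.le, ht.2.le⟩
      all_goals simp only [zero_smul, add_zero, hx₀i]; linarith
    obtain ⟨t, htb, ht⟩ := (hev.and self_mem_nhdsWithin).exists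
    have hxb : x₀ ∈ Q.box := fun i => by
      rw [hx₀i]; constructor <;> linarith [hbox i]
    have key := AffineSubspace.smul_vsub_vadd_mem _ t⁻¹
      (subset_affineSpan ℝ S (Set.mem_image_of_mem _ htb))
      (subset_affineSpan ℝ S (Set.mem_image_of_mem _ hxb)) h0
    rwa [vsub_eq_sub, residual_sub, add_sub_cancel_left, map_smul, smul_smul,
      inv_mul_cancel₀ (Set.mem_Ioi.mp ht).ne', one_smul, vadd_eq_add, add_zero] at key
  obtain ⟨q, hq, hq0⟩ := mem_intrinsicInterior.mp hint
  obtain ⟨ε, hε, hball⟩ := Metric.mem_nhds_iff.mp (mem_interior_iff_mem_nhds.mp hq)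
  refine ⟨ε / 2, by positivity, fun v hv => ?_⟩
  have : (⟨_, hspan v⟩ : affineSpan ℝ S) ∈ Metric.ball q ε := by
    rw [Metric.mem_ball, Subtype.dist_eq, hq0, dist_zero_right]
    linarith
  obtain ⟨x, hx, hxe⟩ := hball this
  exact ⟨x, hx, hxe⟩

/-- A vector of the range of `A` whose pairings with the vectors `A w - b - r`, `w` in the box, are
bounded from below is bounded, if these vectors fill a ball of the range. -/
lemma norm_le_of_forall_le_inner {δ : ℝ} (hδ : 0 < δ)
    (hball : ∀ v, ‖Q.A.toEuclideanLin v‖ ≤ δ → ∃ x ∈ Q.box, Q.residual x = Q.A.toEuclideanLin v)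
    {u v : EuclideanSpace ℝ (Fin n)} (hv : ‖Q.A.toEuclideanLin v‖ ≤ δ / 2) {C : ℝ}
    (h : ∀ w ∈ Q.box,
      -C ≤ ⟪Q.A.toEuclideanLin u, Q.residual w - Q.A.toEuclideanLin v⟫_ℝ) :
    ‖Q.A.toEuclideanLin u‖ ≤ 2 * C / δ := by
  set y := Q.A.toEuclideanLin u with hy
  set t : ℝ := δ / 2 * ‖y‖⁻¹ with ht
  have hty : t * ‖y‖ ≤ δ / 2 := by
    rw [ht, mul_assoc]
    exact mul_le_of_le_one_right (by positivity) inv_mul_le_one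
  obtain ⟨w, hw, hwr⟩ := hball (v - t • u) (by
    rw [map_sub, map_smul, ← hy]
    refine (norm_sub_le _ _).trans ?_
    rw [norm_smul, Real.norm_of_nonneg (by positivity)]
    linarith)
  have h1 := h w hw
  rw [hwr, map_sub, map_smul, ← hy, sub_sub_cancel_left, inner_neg_right, real_inner_smul_right,
    real_inner_self_eq_norm_sq] at h1
  have h2 : t * ‖y‖ ^ 2 = δ / 2 * ‖y‖ := by
    rcases eq_or_ne ‖y‖ 0 with h0 | h0
    · simp [h0]
    · rw [ht]; field_simp
  rw [le_div_iff₀ hδ]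
  linarith

lemma IsRegular.exists_isMinOn {L γ : ℝ} (hQ : Q.IsRegular L γ) (hne : Q.box.Nonempty) (k p : ℝ)
    (z : EuclideanSpace ℝ (Fin n)) (y d : EuclideanSpace ℝ (Fin m)) :
    ∃ x, IsMinOn (fun w => Q.f w + (⟪y, Q.residual w - d⟫_ℝ + k / 2 * ‖Q.residual w - d‖ ^ 2
        + p / 2 * ‖w - z‖ ^ 2)) Q.box x ∧
      Q.IsProxStationary p z x (y + k • (Q.residual x - d)) := by
  obtain ⟨x, hx, hmin⟩ := isCompact_box.exists_isMinOn hne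
    (f := fun w => Q.f w + (⟪y, Q.residual w - d⟫_ℝ + k / 2 * ‖Q.residual w - d‖ ^ 2
        + p / 2 * ‖w - z‖ ^ 2)) (hQ.continuousOn_f.add (by fun_prop))
  refine ⟨x, hmin, hx, fun w hw => ?_⟩
  refine inner_gradient_nonneg_of_isMinOn convex_box hx hmin ?_ hw
  have h1 := (hQ.diff x hx).hasGradientAt
  have h2 := hasGradientAt_residual_terms (Q := Q) x d y z k p
  rw [hasGradientAt_iff_hasFDerivAt] at h1 h2 ⊢
  refine (h1.add h2).congr_fderiv ?_
  rw [← map_add, proxField, add_assoc]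

lemma IsRegular.tendsto_gradient {L γ : ℝ} (hQ : Q.IsRegular L γ) {X : ℕ → EuclideanSpace ℝ (Fin n)}
    {x : EuclideanSpace ℝ (Fin n)} (hX : ∀ k, X k ∈ Q.box) (hx : x ∈ Q.box)
    (h : Tendsto X atTop (𝓝 x)) : Tendsto (fun k => ∇ Q.f (X k)) atTop (𝓝 (∇ Q.f x)) :=
  (hQ.continuousOn_gradient x hx).tendsto.comp
    (tendsto_nhdsWithin_iff.mpr ⟨h, Eventually.of_forall hX⟩)

lemma IsRegular.isProxStationary_of_tendsto {L γ : ℝ} (hQ : Q.IsRegular L γ) {p : ℝ}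
    {z x : EuclideanSpace ℝ (Fin n)} {y : EuclideanSpace ℝ (Fin m)}
    {X : ℕ → EuclideanSpace ℝ (Fin n)} {Y : ℕ → EuclideanSpace ℝ (Fin m)}
    (h : ∀ k, Q.IsProxStationary p z (X k) (Y k)) (hX : Tendsto X atTop (𝓝 x))
    (hY : Tendsto Y atTop (𝓝 y)) : Q.IsProxStationary p z x y := by
  have hx : x ∈ Q.box := isCompact_box.isClosed.mem_of_tendsto hX
    (Eventually.of_forall fun k => (h k).1)
  refine ⟨hx, fun w hw => ?_⟩
  have hF : Tendsto (fun k => Q.proxField p z (X k) (Y k)) atTop (𝓝 (Q.proxField p z x y)) :=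
    ((hQ.tendsto_gradient (fun k => (h k).1) hx hX).add
      ((hX.sub tendsto_const_nhds).const_smul p)).add ((continuous_transpose.tendsto y).comp hY)
  exact ge_of_tendsto' (hF.inner (tendsto_const_nhds.sub hX)) fun k => (h k).2 w hw

lemma IsRegular.exists_norm_proxField_le {L γ : ℝ} (hQ : Q.IsRegular L γ) (p : ℝ)
    (z : EuclideanSpace ℝ (Fin n)) :
    ∃ M : ℝ, 0 ≤ M ∧ ∀ x ∈ Q.box, ‖Q.proxField p z x 0‖ ≤ M := by
  have hc : ContinuousOn (fun x => Q.proxField p z x 0) Q.box :=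
    (hQ.continuousOn_gradient.add (by fun_prop)).add continuousOn_const
  obtain ⟨M, hM⟩ := isCompact_box.exists_bound_of_continuousOn hc
  exact ⟨max M 0, le_max_right _ _, fun x hx => (hM x hx).trans (le_max_left _ _)⟩

/-- Stationary points with a prescribed small residual exist, with uniformly bounded multipliers:
they are limits of the minimizers of quadratic penalty functions, whose approximate multipliers
`k (Ax - b - r)` are bounded because `AP - b` contains a ball of the range of `A`. -/
lemma IsRegular.exists_isProxStationary {L γ : ℝ} (hQ : Q.IsRegular L γ) {δ : ℝ} (hδ : 0 < δ)
    (hball : ∀ v, ‖Q.A.toEuclideanLin v‖ ≤ δ → ∃ x ∈ Q.box, Q.residual x = Q.A.toEuclideanLin v)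
    (p : ℝ) (z : EuclideanSpace ℝ (Fin n)) :
    ∃ B : ℝ, ∀ v, ‖Q.A.toEuclideanLin v‖ ≤ δ / 2 →
      ∃ x y, Q.IsProxStationary p z x y ∧ Q.residual x = Q.A.toEuclideanLin v ∧ ‖y‖ ≤ B := by
  obtain ⟨M, hM0, hM⟩ := hQ.exists_norm_proxField_le p z
  obtain ⟨D, hD0, hD⟩ := exists_norm_sub_le_of_mem_box (Q := Q)
  obtain ⟨x₀, hx₀, hx₀r⟩ := hball 0 (by simpa using hδ.le)
  refine ⟨2 * (M * D) / δ, fun v hv => ?_⟩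
  set r := Q.A.toEuclideanLin v with hr
  have hex : ∀ k : ℕ, ∃ x, Q.IsProxStationary p z x (((k : ℝ) + 1) • (Q.residual x - r)) :=
    fun k => by
      obtain ⟨x, -, hx⟩ := hQ.exists_isMinOn ⟨x₀, hx₀⟩ ((k : ℝ) + 1) p z 0 r
      exact ⟨x, by simpa using hx⟩
  choose X hX using hex
  set Y : ℕ → EuclideanSpace ℝ (Fin m) := fun k => ((k : ℝ) + 1) • (Q.residual (X k) - r) with hY
  have hYr : ∀ k, Y k = Q.A.toEuclideanLin (((k : ℝ) + 1) • (X k - x₀ - v)) := by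
    intro k
    rw [map_smul, map_sub, ← residual_sub, hx₀r, map_zero, sub_zero]
  have hYB : ∀ k, ‖Y k‖ ≤ 2 * (M * D) / δ := by
    intro k
    rw [hYr]
    refine norm_le_of_forall_le_inner hδ hball hv fun w hw => ?_
    rw [← hYr, ← hr]
    have h1 := (hX k).2 w hw
    have h2 : Q.proxField p z (X k) (Y k)
        = Q.proxField p z (X k) 0 + Q.A.transpose.toEuclideanLin (Y k) := by
      simp [proxField]
    have h3 : Q.residual w - r = Q.A.toEuclideanLin (w - X k) + (Q.residual (X k) - r) := by
      rw [← residual_sub]; abel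
    have h4 : 0 ≤ ⟪Y k, Q.residual (X k) - r⟫_ℝ := by
      rw [hY, real_inner_smul_left]
      exact mul_nonneg (by positivity) real_inner_self_nonneg
    have h5 := (real_inner_le_norm (Q.proxField p z (X k) 0) (w - X k)).trans
      (mul_le_mul (hM _ (hX k).1) (hD w hw _ (hX k).1) (norm_nonneg _) hM0)
    rw [h2, inner_add_left, inner_transpose] at h1
    rw [h3, inner_add_right]
    linarith
  obtain ⟨⟨x, y⟩, hxy, φ, hφ, hlim⟩ :=
    (isCompact_box.prod (isCompact_closedBall (0 : EuclideanSpace ℝ (Fin m))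
      (2 * (M * D) / δ))).tendsto_subseq (x := fun k => (X k, Y k))
      fun k => ⟨(hX k).1, by simpa using hYB k⟩
  have hXl : Tendsto (X ∘ φ) atTop (𝓝 x) := (continuous_fst.tendsto _).comp hlim
  have hYl : Tendsto (Y ∘ φ) atTop (𝓝 y) := (continuous_snd.tendsto _).comp hlim
  refine ⟨x, y, hQ.isProxStationary_of_tendsto (fun k => hX (φ k)) hXl hYl, ?_, by
    simpa using hxy.2⟩
  have h1 : Tendsto (fun k => Q.residual (X (φ k)) - r) atTop (𝓝 (Q.residual x - r)) :=
    ((continuous_residual.tendsto x).comp hXl).sub_const r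
  have h2 : Tendsto (fun k => Q.residual (X (φ k)) - r) atTop (𝓝 0) := by
    have h3 : Tendsto (fun k : ℕ => (1 / ((φ k : ℝ) + 1)) • Y (φ k)) atTop (𝓝 ((0 : ℝ) • y)) :=
      (tendsto_one_div_add_atTop_nhds_zero_nat.comp hφ.tendsto_atTop).smul hYl
    rw [zero_smul] at h3
    refine h3.congr fun k => ?_
    have : ((φ k : ℝ) + 1) ≠ 0 := by positivity
    rw [hY, smul_smul, one_div_mul_cancel this, one_smul]
  exact sub_eq_zero.mp (tendsto_nhds_unique h1 h2)

/-! ### The global dual error bound -/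

lemma IsRegular.eq_of_isProxStationary {L γ : ℝ} (hQ : Q.IsRegular L γ) {p : ℝ} (hp : 0 < p + γ)
    {z x x' : EuclideanSpace ℝ (Fin n)} {y y' : EuclideanSpace ℝ (Fin m)}
    (h : Q.IsProxStationary p z x y) (h' : Q.IsProxStationary p z x' y')
    (hr : Q.residual x = Q.residual x') : x = x' := by
  have h1 := hQ.norm_sub_sq_le_of_isProxStationary h h'
  rw [hr, sub_self, inner_zero_right] at h1
  have h2 : ‖x - x'‖ ^ 2 ≤ 0 := nonpos_of_mul_nonpos_right h1 hp
  exact sub_eq_zero.mp (norm_eq_zero.mp (pow_eq_zero_iff two_ne_zero |>.mp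
    (le_antisymm h2 (sq_nonneg _))))

/-- **Global dual error bound**: the stationary point `x₁` of the relaxed problem is at distance at
most a constant times its residual from the solution `x₀` of the constrained proximal problem,
uniformly in `z` and in the multipliers. The residual is scaled down to `0` linearly. The
stationary points with these residuals form a continuous curve, near each of its points the active
set can only shrink, and then multipliers can be chosen so close to each other that strong
monotonicity turns into a Lipschitz estimate. -/
theorem IsRegular.exists_dual_error_bound {L γ : ℝ} (hQ : Q.IsRegular L γ) {δ : ℝ} (hδ : 0 < δ)
    (hball : ∀ v, ‖Q.A.toEuclideanLin v‖ ≤ δ → ∃ x ∈ Q.box, Q.residual x = Q.A.toEuclideanLin v)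
    {p : ℝ} (hL : 0 ≤ L) (hp : 0 ≤ p) (hpγ : 0 < p + γ) :
    ∃ κ : ℝ, 0 ≤ κ ∧ ∀ z x₁ y₁ x₀ y₀, Q.IsProxStationary p z x₁ y₁ → Q.IsProxStationary p z x₀ y₀ →
      Q.residual x₀ = 0 → ‖x₁ - x₀‖ ≤ κ * ‖Q.residual x₁‖ := by
  obtain ⟨D, hD0, hD⟩ := exists_norm_sub_le_of_mem_box (Q := Q)
  obtain ⟨C, hC0, hC⟩ := exists_multiplier_near Q
  refine ⟨C * (L + p) / (p + γ) + 2 * D / δ, by positivity, fun z x₁ y₁ x₀ y₀ h₁ h₀ hr₀ => ?_⟩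
  set v := x₁ - x₀ with hv
  have hr₁ : Q.residual x₁ = Q.A.toEuclideanLin v := by rw [hv, ← residual_sub, hr₀, sub_zero]
  rw [hr₁]
  set r := Q.A.toEuclideanLin v with hr
  rcases lt_or_ge (δ / 2) ‖r‖ with hbig | hsmall
  · have h1 : D ≤ 2 * D / δ * ‖r‖ := by
      rw [div_mul_eq_mul_div, le_div_iff₀ hδ]
      nlinarith
    have h2 : 0 ≤ C * (L + p) / (p + γ) * ‖r‖ := by positivity
    linarith [hD x₁ h₁.1 x₀ h₀.1]
  obtain ⟨B, hB⟩ := hQ.exists_isProxStationary hδ hball p z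
  have hex : ∀ s : ℝ, ∃ x y, s ∈ Set.Icc (0 : ℝ) 1 →
      Q.IsProxStationary p z x y ∧ Q.residual x = s • r ∧ ‖y‖ ≤ B := by
    intro s
    by_cases hs : s ∈ Set.Icc (0 : ℝ) 1
    · obtain ⟨x, y, h⟩ := hB (s • v) (by
        rw [map_smul, norm_smul, Real.norm_of_nonneg hs.1]
        exact (mul_le_of_le_one_left (norm_nonneg _) hs.2).trans hsmall)
      exact ⟨x, y, fun _ => by simpa using h⟩
    · exact ⟨0, 0, fun h => absurd h hs⟩
  choose X Y hXY using hex
  have hX0 : X 0 = x₀ := by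
    have h := hXY 0 (by simp)
    exact hQ.eq_of_isProxStationary hpγ h.1 h₀ (by rw [h.2.1, hr₀, zero_smul])
  have hX1 : X 1 = x₁ := by
    have h := hXY 1 (by simp)
    exact hQ.eq_of_isProxStationary hpγ h.1 h₁ (by rw [h.2.1, hr₁, one_smul])
  have hdiff : ∀ s ∈ Set.Icc (0 : ℝ) 1, ∀ t ∈ Set.Icc (0 : ℝ) 1,
      Q.residual (X s) - Q.residual (X t) = (s - t) • r := fun s hs t ht => by
    rw [(hXY s hs).2.1, (hXY t ht).2.1, sub_smul]
  have hcont : ContinuousOn X (Set.Icc 0 1) := by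
    intro s hs
    have hbd : ∀ t ∈ Set.Icc (0 : ℝ) 1,
        ‖X t - X s‖ ^ 2 ≤ 2 * B * ‖r‖ / (p + γ) * |t - s| := by
      intro t ht
      have h1 := hQ.norm_sub_sq_le_of_isProxStationary (hXY t ht).1 (hXY s hs).1
      have h2 := real_inner_le_norm (Y s - Y t) (Q.residual (X t) - Q.residual (X s))
      have h3 : ‖Y s - Y t‖ ≤ 2 * B := by
        linarith [norm_sub_le (Y s) (Y t), (hXY s hs).2.2, (hXY t ht).2.2]
      rw [hdiff t ht s hs, norm_smul, Real.norm_eq_abs] at h2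
      rw [hdiff t ht s hs] at h1
      rw [div_mul_eq_mul_div, le_div_iff₀ hpγ]
      have h4 : 0 ≤ |t - s| * ‖r‖ := by positivity
      nlinarith [mul_le_mul_of_nonneg_right h3 h4]
    rw [ContinuousWithinAt, tendsto_iff_norm_sub_tendsto_zero]
    have h1 : Tendsto (fun t => 2 * B * ‖r‖ / (p + γ) * |t - s|) (𝓝[Set.Icc 0 1] s) (𝓝 0) := by
      have : ContinuousAt (fun t => 2 * B * ‖r‖ / (p + γ) * |t - s|) s := by fun_prop
      simpa [ContinuousAt] using this.tendsto.mono_left nhdsWithin_le_nhds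
    have h2 : Tendsto (fun t => ‖X t - X s‖ ^ 2) (𝓝[Set.Icc 0 1] s) (𝓝 0) :=
      squeeze_zero' (Eventually.of_forall fun t => sq_nonneg _)
        (eventually_mem_nhdsWithin.mono hbd) h1
    simpa using h2.sqrt
  have hlocal : ∀ s ∈ Set.Ico (0 : ℝ) 1, ∀ᶠ t in 𝓝[>] s,
      ‖X t - X s‖ ≤ C * (L + p) / (p + γ) * ‖r‖ * (t - s) := by
    intro s hs
    have hsI := Set.Ico_subset_Icc_self hs
    have hcs : Tendsto X (𝓝[>] s) (𝓝 (X s)) := by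
      refine (hcont s hsI).tendsto.mono_left ?_
      rw [← nhdsWithin_Ioo_eq_nhdsGT hs.2]
      exact nhdsWithin_mono _ fun t ht => ⟨hs.1.trans ht.1.le, ht.2.le⟩
    have hci : ∀ i, Tendsto (fun t => X t i) (𝓝[>] s) (𝓝 (X s i)) := fun i =>
      ((PiLp.continuous_apply 2 _ i).tendsto _).comp hcs
    have hlow : ∀ᶠ t in 𝓝[>] s, ∀ i, Q.lower i < X s i → Q.lower i < X t i := by
      refine Filter.eventually_all.mpr fun i => ?_
      by_cases hi : Q.lower i < X s i
      · exact ((hci i).eventually_const_lt hi).mono fun t ht _ => ht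
      · exact Eventually.of_forall fun t h => absurd h hi
    have hupp : ∀ᶠ t in 𝓝[>] s, ∀ i, X s i < Q.upper i → X t i < Q.upper i := by
      refine Filter.eventually_all.mpr fun i => ?_
      by_cases hi : X s i < Q.upper i
      · exact ((hci i).eventually_lt_const hi).mono fun t ht _ => ht
      · exact Eventually.of_forall fun t h => absurd h hi
    filter_upwards [hlow, hupp, Ioo_mem_nhdsGT hs.2] with t htl htu htm
    have htI : t ∈ Set.Icc (0 : ℝ) 1 := ⟨hs.1.trans htm.1.le, htm.2.le⟩
    have hs1 := (hXY s hsI).1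
    have ht1 := (hXY t htI).1
    obtain ⟨y', hy', hyd⟩ := hC (X s) (X t) (∇ Q.f (X s) + p • (X s - z))
      (∇ Q.f (X t) + p • (X t - z)) (Y s) (Y t) hs1.1 ht1.1 htl htu hs1.2 ht1.2
    have h1 := hQ.norm_sub_sq_le_of_isProxStationary ht1 (⟨hs1.1, hy'⟩ : Q.IsProxStationary p z _ _)
    have h2 := real_inner_le_norm (y' - Y t) (Q.residual (X t) - Q.residual (X s))
    rw [norm_sub_rev y', hdiff t htI s hsI, norm_smul,
      Real.norm_of_nonneg (sub_pos.mpr htm.1).le] at h2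
    rw [hdiff t htI s hsI] at h1
    have h3 : ‖∇ Q.f (X t) + p • (X t - z) - (∇ Q.f (X s) + p • (X s - z))‖
        ≤ (L + p) * ‖X t - X s‖ := by
      have : ∇ Q.f (X t) + p • (X t - z) - (∇ Q.f (X s) + p • (X s - z))
          = (∇ Q.f (X t) - ∇ Q.f (X s)) + p • (X t - X s) := by module
      rw [this, add_mul]
      refine (norm_add_le _ _).trans (add_le_add (hQ.lip _ ht1.1 _ hs1.1) ?_)
      rw [norm_smul, Real.norm_of_nonneg hp]
    have h4 : ‖Y t - y'‖ ≤ C * ((L + p) * ‖X t - X s‖) :=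
      hyd.trans (mul_le_mul_of_nonneg_left h3 hC0)
    have h5 : 0 ≤ (t - s) * ‖r‖ := mul_nonneg (sub_pos.mpr htm.1).le (norm_nonneg _)
    have h6 : (p + γ) * ‖X t - X s‖ ^ 2
        ≤ C * ((L + p) * ‖X t - X s‖) * ((t - s) * ‖r‖) :=
      h1.trans (h2.trans (mul_le_mul_of_nonneg_right h4 h5))
    rw [div_mul_eq_mul_div, div_mul_eq_mul_div, le_div_iff₀ hpγ]
    rcases (norm_nonneg (X t - X s)).eq_or_lt with h0 | h0
    · rw [← h0, zero_mul]
      exact mul_nonneg (by positivity) (sub_pos.mpr htm.1).le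
    · nlinarith
  have hfin := norm_sub_le_of_eventually_norm_sub_le hcont hlocal
  rw [hX0, hX1] at hfin
  have : 0 ≤ 2 * D / δ * ‖r‖ := by positivity
  linarith

/-! ### Decrease of the potential function -/

lemma proxLagrangian_sub_prox (Γ p : ℝ) (x z z' : EuclideanSpace ℝ (Fin n))
    (y : EuclideanSpace ℝ (Fin m)) :
    Q.proxLagrangian Γ p x z' y - Q.proxLagrangian Γ p x z y
      = p / 2 * (‖x - z'‖ ^ 2 - ‖x - z‖ ^ 2) := by
  simp only [proxLagrangian]; ring

lemma proxLagrangian_sub_dual (Γ p : ℝ) (x z : EuclideanSpace ℝ (Fin n))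
    (y y' : EuclideanSpace ℝ (Fin m)) :
    Q.proxLagrangian Γ p x z y' - Q.proxLagrangian Γ p x z y = ⟪y' - y, Q.residual x⟫_ℝ := by
  simp only [proxLagrangian, augLagrangian, inner_sub_left]; ring

lemma proxLagrangian_of_residual_eq_zero (Γ p : ℝ) {x : EuclideanSpace ℝ (Fin n)}
    (hx : Q.residual x = 0) (z : EuclideanSpace ℝ (Fin n)) (y : EuclideanSpace ℝ (Fin m)) :
    Q.proxLagrangian Γ p x z y = Q.f x + p / 2 * ‖x - z‖ ^ 2 := by
  simp [proxLagrangian, augLagrangian, hx]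

/-- The constrained proximal problem has a minimizer, and it has a multiplier. -/
lemma IsRegular.exists_constrained_minimizer {L γ : ℝ} (hQ : Q.IsRegular L γ) {δ : ℝ} (hδ : 0 < δ)
    (hball : ∀ v, ‖Q.A.toEuclideanLin v‖ ≤ δ → ∃ x ∈ Q.box, Q.residual x = Q.A.toEuclideanLin v)
    {p : ℝ} (hpγ : 0 < p + γ) (z : EuclideanSpace ℝ (Fin n)) :
    ∃ x y, Q.IsProxStationary p z x y ∧ Q.residual x = 0 ∧
      ∀ w ∈ Q.box, Q.residual w = 0 →
        Q.f x + p / 2 * ‖x - z‖ ^ 2 ≤ Q.f w + p / 2 * ‖w - z‖ ^ 2 := by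
  obtain ⟨B, hB⟩ := hQ.exists_isProxStationary hδ hball p z
  obtain ⟨x, y, hxy, hxr, -⟩ := hB 0 (by simpa using (half_pos hδ).le)
  rw [map_zero] at hxr
  refine ⟨x, y, hxy, hxr, ?_⟩
  set S : Set (EuclideanSpace ℝ (Fin n)) := Q.box ∩ Q.residual ⁻¹' {0} with hS
  have hSc : IsCompact S :=
    isCompact_box.inter_right (isClosed_singleton.preimage continuous_residual)
  have hSconv : Convex ℝ S := by
    refine convex_box.inter fun u hu v hv s t hs ht hst => ?_
    have h : Q.residual (s • u + t • v) = s • Q.residual u + t • Q.residual v := by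
      simp only [residual, map_add, map_smul, smul_sub]
      nth_rewrite 1 [← one_smul ℝ Q.b]
      rw [← hst]
      module
    have hu' : Q.residual u = 0 := hu
    have hv' : Q.residual v = 0 := hv
    simp [h, hu', hv']
  obtain ⟨x', hx', hmin⟩ := hSc.exists_isMinOn ⟨x, hxy.1, hxr⟩
    (f := fun w => Q.proxLagrangian 0 p w z 0)
    (fun w hw => (hQ.hasGradientAt_proxLagrangian 0 p hw.1 z 0).continuousAt.continuousWithinAt)
  have hx'r : Q.residual x' = 0 := hx'.2
  have h1 := inner_gradient_nonneg_of_isMinOn hSconv hx' hmin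
    (hQ.hasGradientAt_proxLagrangian 0 p hx'.1 z 0) (w := x) ⟨hxy.1, hxr⟩
  have h2 := hxy.2 x' hx'.1
  have h3 := hQ.le_inner_proxField_sub le_rfl p hxy.1 hx'.1 z 0
  have h4 : ⟪y, Q.A.toEuclideanLin (x' - x)⟫_ℝ = 0 := by
    rw [← residual_sub, hx'r, hxr, sub_zero, inner_zero_right]
  rw [← inner_transpose] at h4
  have h5 : (p + γ) * ‖x - x'‖ ^ 2 ≤ 0 := by
    simp only [proxField, map_zero, zero_smul, add_zero, inner_add_left,
      inner_sub_left, inner_sub_right] at h1 h2 h3 h4 ⊢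
    linarith
  have h6 : x = x' := sub_eq_zero.mp (norm_eq_zero.mp (pow_eq_zero_iff two_ne_zero |>.mp
    (le_antisymm (nonpos_of_mul_nonpos_right h5 hpγ) (sq_nonneg _))))
  intro w hw hwr
  have h7 := hmin (⟨hw, hwr⟩ : w ∈ S)
  simp only [Set.mem_ofPred_eq] at h7
  rwa [proxLagrangian_of_residual_eq_zero 0 p hx'r, proxLagrangian_of_residual_eq_zero 0 p hwr,
    ← h6] at h7

lemma IsRegular.gradient_proxLagrangian {L γ : ℝ} (hQ : Q.IsRegular L γ) (Γ p : ℝ)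
    {x : EuclideanSpace ℝ (Fin n)} (hx : x ∈ Q.box) (z : EuclideanSpace ℝ (Fin n))
    (y : EuclideanSpace ℝ (Fin m)) :
    ∇ (fun w => Q.proxLagrangian Γ p w z y) x = Q.proxField p z x (y + Γ • Q.residual x) :=
  (hQ.hasGradientAt_proxLagrangian Γ p hx z y).gradient

/-- Sufficient decrease of the proximal Lagrangian in a projected gradient step. -/
lemma IsRegular.proxLagrangian_proj_le {L γ : ℝ} (hQ : Q.IsRegular L γ)
    (hbox : ∀ i, Q.lower i < Q.upper i) {Γ p c : ℝ} (hΓ : 0 ≤ Γ) (hp : 0 ≤ p) (hc : 0 < c)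
    (hcL : c * (L + p + Γ * Q.sigma ^ 2) ≤ 1) {x z x' : EuclideanSpace ℝ (Fin n)}
    {y : EuclideanSpace ℝ (Fin m)} (hx : x ∈ Q.box)
    (hx' : x' = Q.proj (x - c • Q.proxField p z x (y + Γ • Q.residual x))) :
    Q.proxLagrangian Γ p x' z y ≤ Q.proxLagrangian Γ p x z y - 1 / (2 * c) * ‖x' - x‖ ^ 2 := by
  have hx'b : x' ∈ Q.box := hx' ▸ proj_mem_box hbox _
  have h1 := le_add_inner_gradient_of_lipschitz (f := fun w => Q.proxLagrangian Γ p w z y)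
    convex_box (L := L + p + Γ * Q.sigma ^ 2)
    (fun w hw => (hQ.hasGradientAt_proxLagrangian Γ p hw z y).differentiableAt)
    (fun w hw w' hw' => by
      rw [hQ.gradient_proxLagrangian Γ p hw, hQ.gradient_proxLagrangian Γ p hw']
      exact hQ.norm_proxField_sub_le hΓ hp hw hw' z y) hx hx'b
  rw [hQ.gradient_proxLagrangian Γ p hx] at h1
  have h2 := inner_proj_sub_nonneg hbox (x - c • Q.proxField p z x (y + Γ • Q.residual x)) hx
  rw [← hx'] at h2
  set g := Q.proxField p z x (y + Γ • Q.residual x)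
  have h3 : x' - (x - c • g) = (x' - x) + c • g := by abel
  rw [h3, ← neg_sub x' x, inner_neg_right, inner_add_left, real_inner_smul_left,
    real_inner_self_eq_norm_sq] at h2
  have h4 : 1 / (2 * c) * ‖x' - x‖ ^ 2 = ‖x' - x‖ ^ 2 / c - ‖x' - x‖ ^ 2 / (2 * c) := by
    field_simp; ring
  have h5 : ⟪g, x' - x⟫_ℝ ≤ -(‖x' - x‖ ^ 2 / c) := by
    rw [← neg_div, le_div_iff₀ hc]; linarith
  have h6 : (L + p + Γ * Q.sigma ^ 2) / 2 * ‖x' - x‖ ^ 2 ≤ ‖x' - x‖ ^ 2 / (2 * c) := by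
    rw [le_div_iff₀ (by positivity)]
    nlinarith [mul_le_mul_of_nonneg_right hcL (sq_nonneg ‖x' - x‖)]
  linarith

/-- Primal error bound: the length of a projected gradient step controls the distance to the
stationary point of the proximal Lagrangian. -/
lemma IsRegular.norm_sub_le_norm_proj_sub {L γ : ℝ} (hQ : Q.IsRegular L γ)
    (hbox : ∀ i, Q.lower i < Q.upper i) {Γ p c : ℝ} (hL : 0 ≤ L) (hΓ : 0 ≤ Γ) (hp : 0 ≤ p)
    (hc : 0 < c) (hpγ : 0 < p + γ) {x z x' w : EuclideanSpace ℝ (Fin n)}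
    {y : EuclideanSpace ℝ (Fin m)} (hx : x ∈ Q.box)
    (hx' : x' = Q.proj (x - c • Q.proxField p z x (y + Γ • Q.residual x)))
    (hw : Q.IsProxStationary p z w (y + Γ • Q.residual w)) :
    ‖x - w‖ ≤ (1 + c * (L + p + Γ * Q.sigma ^ 2)) / (c * (p + γ)) * ‖x' - x‖ := by
  have hx'b : x' ∈ Q.box := hx' ▸ proj_mem_box hbox _
  have h1 := inner_proj_sub_nonneg hbox (x - c • Q.proxField p z x (y + Γ • Q.residual x)) hw.1
  rw [← hx'] at h1
  have h2 := hw.2 x' hx'b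
  have h3 := hQ.le_inner_proxField_sub hΓ p hx hw.1 z y
  have h4 := hQ.norm_proxField_sub_le hΓ hp hx hw.1 z y
  set g := Q.proxField p z x (y + Γ • Q.residual x)
  set g' := Q.proxField p z w (y + Γ • Q.residual w)
  have h5 := (real_inner_le_norm (g - g') (x - x')).trans
    (mul_le_mul_of_nonneg_right h4 (norm_nonneg _))
  rw [norm_sub_rev x x'] at h5
  have h6 := real_inner_le_norm (x' - x) (w - x)
  rw [norm_sub_rev w x] at h6
  have h7 : c * ⟪g - g', x - w⟫_ℝ ≤ ⟪x' - x, w - x⟫_ℝ + c * ⟪g - g', x - x'⟫_ℝ := by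
    have e1 : ⟪x' - (x - c • g), w - x'⟫_ℝ
        = ⟪x' - x, w - x⟫_ℝ - ‖x' - x‖ ^ 2 + c * ⟪g, w - x'⟫_ℝ := by
      rw [show x' - (x - c • g) = (x' - x) + c • g by abel, inner_add_left, real_inner_smul_left,
        show w - x' = (w - x) - (x' - x) by abel, inner_sub_right (x' - x),
        real_inner_self_eq_norm_sq]
    have e2 : ⟪g - g', x - w⟫_ℝ = ⟪g - g', x - x'⟫_ℝ - ⟪g, w - x'⟫_ℝ - ⟪g', x' - w⟫_ℝ := by
      simp only [inner_sub_left, inner_sub_right]; ring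
    rw [e1] at h1
    rw [e2]
    nlinarith [sq_nonneg ‖x' - x‖, mul_nonneg hc.le h2]
  rw [div_mul_eq_mul_div, le_div_iff₀ (by positivity)]
  rcases (norm_nonneg (x - w)).eq_or_lt with h0 | h0
  · rw [← h0, zero_mul]
    positivity
  · refine le_of_mul_le_mul_right (a := ‖x - w‖) ?_ h0
    nlinarith [mul_le_mul_of_nonneg_left h3 hc.le, mul_le_mul_of_nonneg_left h5 hc.le]

/-- The minimizer of the proximal Lagrangian depends on the proximal center in a Lipschitz way. -/
lemma IsRegular.norm_sub_le_of_center {L γ : ℝ} (hQ : Q.IsRegular L γ) {Γ p : ℝ} (hΓ : 0 ≤ Γ)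
    (hp : 0 ≤ p) (hpγ : 0 < p + γ) {z z' w w' : EuclideanSpace ℝ (Fin n)}
    {y : EuclideanSpace ℝ (Fin m)} (hw : Q.IsProxStationary p z w (y + Γ • Q.residual w))
    (hw' : Q.IsProxStationary p z' w' (y + Γ • Q.residual w')) :
    ‖w - w'‖ ≤ p / (p + γ) * ‖z - z'‖ := by
  have h1 := hw.2 w' hw'.1
  have h2 := hw'.2 w hw.1
  have h3 := hQ.le_inner_proxField_sub hΓ p hw.1 hw'.1 z y
  have h4 : Q.proxField p z' w' (y + Γ • Q.residual w')
      = Q.proxField p z w' (y + Γ • Q.residual w') + p • (z - z') := by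
    simp only [proxField]; module
  rw [h4, inner_add_left, real_inner_smul_left] at h2
  rw [← neg_sub w w', inner_neg_right] at h1
  rw [inner_sub_left] at h3
  have h5 : (p + γ) * ‖w - w'‖ ^ 2 ≤ p * (‖z - z'‖ * ‖w - w'‖) := by
    linarith [mul_le_mul_of_nonneg_left (real_inner_le_norm (z - z') (w - w')) hp]
  rw [div_mul_eq_mul_div, le_div_iff₀ hpγ]
  rcases (norm_nonneg (w - w')).eq_or_lt with h0 | h0
  · rw [← h0, zero_mul]
    positivity
  · nlinarith

/-- One step of the method decreases the potential `K - 2 d + 2 M`, where `d` and `M` are the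
optimal values of the proximal Lagrangian on the box and of the constrained proximal problem, and
`w`, `w'`, `v` are minimizers defining `d(y, z)`, `d(y', z')`, `d(y', z)` and `s`, `s'` those
defining `M(z)`, `M(z')`. The move of the proximal center contributes a term of indefinite sign, the
pairing of `z' - z` with `w' - s`; the error bound `‖v - s‖ ≤ κ ‖A v - b‖` absorbs it. -/
lemma IsRegular.potential_decrease {L γ : ℝ} (hQ : Q.IsRegular L γ)
    (hbox : ∀ i, Q.lower i < Q.upper i) {Γ p c α β κ ρ : ℝ} (hL : 0 ≤ L) (hΓ : 0 ≤ Γ) (hp : 0 < p)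
    (hpγ : 0 < p + γ) (hc : 0 < c) (hcL : c * (L + p + Γ * Q.sigma ^ 2) ≤ 1)
    (hρ : ρ = (1 + c * (L + p + Γ * Q.sigma ^ 2)) / (c * (p + γ)))
    (hα : 0 < α) (hαs : α * (Q.sigma * ρ) ^ 2 ≤ 1 / (4 * c)) (hβ : 0 < β) (hβ1 : β ≤ 1)
    (hβp : 16 * p * β ≤ p + γ) (hβκ : 16 * p * κ ^ 2 * β ≤ α)
    {x z x' z' w w' v s s' : EuclideanSpace ℝ (Fin n)} {y y' : EuclideanSpace ℝ (Fin m)}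
    (hx : x ∈ Q.box) (hy' : y' = y + α • Q.residual x)
    (hx' : x' = Q.proj (x - c • Q.proxField p z x (y' + Γ • Q.residual x)))
    (hz' : z' = z + β • (x' - z))
    (hw : IsMinOn (fun u => Q.proxLagrangian Γ p u z y) Q.box w)
    (hw's : Q.IsProxStationary p z' w' (y' + Γ • Q.residual w'))
    (hvs : Q.IsProxStationary p z v (y' + Γ • Q.residual v))
    (hv : IsMinOn (fun u => Q.proxLagrangian Γ p u z y') Q.box v)
    (hs : Q.f s' + p / 2 * ‖s' - z'‖ ^ 2 ≤ Q.f s + p / 2 * ‖s - z'‖ ^ 2)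
    (hκ : ‖v - s‖ ≤ κ * ‖Q.residual v‖) :
    (Q.proxLagrangian Γ p x' z' y' - 2 * Q.proxLagrangian Γ p w' z' y'
        + 2 * (Q.f s' + p / 2 * ‖s' - z'‖ ^ 2))
      + (1 / (4 * c) * ‖x' - x‖ ^ 2 + α / 2 * ‖Q.residual v‖ ^ 2 + p * β / 4 * ‖x' - z‖ ^ 2)
    ≤ Q.proxLagrangian Γ p x z y - 2 * Q.proxLagrangian Γ p w z y
        + 2 * (Q.f s + p / 2 * ‖s - z‖ ^ 2) := by
  have hyy : y' - y = α • Q.residual x := by rw [hy', add_sub_cancel_left]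
  have hzz : z' - z = β • (x' - z) := by rw [hz', add_sub_cancel_left]
  -- primal descent
  have p1 := proxLagrangian_sub_dual (Q := Q) Γ p x z y y'
  rw [hyy, real_inner_smul_left, real_inner_self_eq_norm_sq] at p1
  have p2 := hQ.proxLagrangian_proj_le hbox hΓ hp.le hc hcL hx hx'
  have p3 := proxLagrangian_sub_prox (Q := Q) Γ p x' z z' y'
  have p4 : ‖x' - z'‖ ^ 2 = (1 - β) ^ 2 * ‖x' - z‖ ^ 2 := by
    rw [show x' - z' = (1 - β) • (x' - z) by rw [hz']; module, norm_smul, mul_pow,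
      Real.norm_eq_abs, sq_abs]
  rw [p4] at p3
  -- dual ascent
  have d1 := proxLagrangian_sub_dual (Q := Q) Γ p v z y y'
  rw [hyy, real_inner_smul_left] at d1
  have d2 : Q.proxLagrangian Γ p w z y ≤ Q.proxLagrangian Γ p v z y := hw hvs.1
  have d3 := proxLagrangian_sub_prox (Q := Q) Γ p w' z z' y'
  have d4 : Q.proxLagrangian Γ p v z y' ≤ Q.proxLagrangian Γ p w' z y' := hv hw's.1
  -- the two differences of squared distances to the proximal centers combine to one pairing
  have e1 : (‖s - z'‖ ^ 2 - ‖s - z‖ ^ 2) - (‖w' - z'‖ ^ 2 - ‖w' - z‖ ^ 2)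
      = 2 * β * ⟪x' - z, w' - s⟫_ℝ := by
    have h1 : ∀ u : EuclideanSpace ℝ (Fin n), ‖u - z'‖ ^ 2 - ‖u - z‖ ^ 2
        = ‖z' - z‖ ^ 2 - 2 * ⟪z' - z, u - z⟫_ℝ := fun u => by
      rw [show u - z' = (u - z) - (z' - z) by abel, norm_sub_sq_real, real_inner_comm]; ring
    have h2 : ⟪x' - z, w' - s⟫_ℝ = ⟪x' - z, w' - z⟫_ℝ - ⟪x' - z, s - z⟫_ℝ := by
      rw [← inner_sub_right, sub_sub_sub_cancel_right]
    rw [h1, h1, hzz, real_inner_smul_left, real_inner_smul_left, h2]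
    ring
  have e2 : ‖w' - s‖ ≤ p / (p + γ) * (β * ‖x' - z‖) + κ * ‖Q.residual v‖ := by
    have h1 := hQ.norm_sub_le_of_center hΓ hp.le hpγ hw's hvs
    rw [hzz, norm_smul, Real.norm_of_nonneg hβ.le] at h1
    calc ‖w' - s‖ = ‖(w' - v) + (v - s)‖ := by congr 1; abel
      _ ≤ _ := (norm_add_le _ _).trans (add_le_add h1 hκ)
  have e3 := (real_inner_le_norm (x' - z) (w' - s)).trans
    (mul_le_mul_of_nonneg_left e2 (norm_nonneg _))
  -- the residual at the iterate is close to the one at the minimizer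
  have r1 : ‖Q.residual x - Q.residual v‖ ≤ Q.sigma * (ρ * ‖x' - x‖) := by
    rw [residual_sub, hρ]
    exact (norm_map_le _).trans (mul_le_mul_of_nonneg_left
      (hQ.norm_sub_le_norm_proj_sub hbox hL hΓ hp.le hc hpγ hx hx' hvs) sigma_nonneg)
  have r2 : α * ‖Q.residual x - Q.residual v‖ ^ 2 ≤ 1 / (4 * c) * ‖x' - x‖ ^ 2 := by
    have h1 : ‖Q.residual x - Q.residual v‖ ^ 2 ≤ (Q.sigma * ρ) ^ 2 * ‖x' - x‖ ^ 2 := by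
      rw [← mul_pow, mul_assoc]
      exact pow_le_pow_left₀ (norm_nonneg _) r1 2
    calc α * ‖Q.residual x - Q.residual v‖ ^ 2
        ≤ α * ((Q.sigma * ρ) ^ 2 * ‖x' - x‖ ^ 2) := mul_le_mul_of_nonneg_left h1 hα.le
      _ = α * (Q.sigma * ρ) ^ 2 * ‖x' - x‖ ^ 2 := by ring
      _ ≤ _ := mul_le_mul_of_nonneg_right hαs (sq_nonneg _)
  rw [norm_sub_sq_real] at r2
  have c1 : 1 / (2 * c) * ‖x' - x‖ ^ 2 = 2 * (1 / (4 * c) * ‖x' - x‖ ^ 2) := by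
    field_simp; ring
  set E := ‖x' - z‖
  set a := ‖Q.residual v‖
  have c2 : 2 * p * β * (E * (κ * a)) ≤ p * β / 8 * E ^ 2 + α / 2 * a ^ 2 := by
    have h1 := mul_le_mul_of_nonneg_right hβκ (sq_nonneg a)
    have h2 : 0 ≤ p * β / 8 * (E - 8 * (κ * a)) ^ 2 := by positivity
    have h3 : p * β / 8 * (E - 8 * (κ * a)) ^ 2 = p * β / 8 * E ^ 2 - 2 * p * β * (E * (κ * a))
        + 16 * p * κ ^ 2 * β * a ^ 2 / 2 := by ring
    linarith
  have c3 : 2 * p * β * (E * (p / (p + γ) * (β * E))) ≤ p * β / 8 * E ^ 2 := by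
    have h1 : p / (p + γ) * β ≤ 1 / 16 := by
      rw [div_mul_eq_mul_div, div_le_iff₀ hpγ]; linarith
    have h2 : 0 ≤ 2 * p * β * E ^ 2 := by positivity
    calc 2 * p * β * (E * (p / (p + γ) * (β * E)))
        = 2 * p * β * E ^ 2 * (p / (p + γ) * β) := by ring
      _ ≤ 2 * p * β * E ^ 2 * (1 / 16) := mul_le_mul_of_nonneg_left h1 h2
      _ = p * β / 8 * E ^ 2 := by ring
  have c4 : (1 - β) ^ 2 * E ^ 2 - E ^ 2 ≤ -(β * E ^ 2) := by
    have h1 := mul_nonneg (mul_nonneg hβ.le (sub_nonneg.mpr hβ1)) (sq_nonneg E)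
    linarith
  have c5 := mul_le_mul_of_nonneg_left e3 (by positivity : 0 ≤ 2 * p * β)
  have c6 := mul_le_mul_of_nonneg_left c4 (by positivity : 0 ≤ p / 2)
  have e1' : p * ((‖s - z'‖ ^ 2 - ‖s - z‖ ^ 2) - (‖w' - z'‖ ^ 2 - ‖w' - z‖ ^ 2))
      = 2 * p * β * ⟪x' - z, w' - s⟫_ℝ := by rw [e1]; ring
  linarith

end BoxProblem

/-! ### Sequences in compact sets -/

section Sequences

lemma tendsto_zero_of_add_le {φ g : ℕ → ℝ} {B : ℝ} (hB : ∀ t, B ≤ φ t) (hg : ∀ t, 0 ≤ g t)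
    (h : ∀ t, φ (t + 1) + g t ≤ φ t) : Tendsto g atTop (𝓝 0) := by
  have hanti : Antitone φ := antitone_nat_of_succ_le fun t => by linarith [h t, hg t]
  have hlim := tendsto_atTop_ciInf hanti ⟨B, Set.forall_mem_range.mpr hB⟩
  have hdiff := hlim.sub (hlim.comp (tendsto_add_atTop_nat 1))
  rw [sub_self] at hdiff
  exact squeeze_zero hg (fun t => by simpa using by linarith [h t]) hdiff

/-- Along a sequence in a compact set, a continuous function tends to `0` if it vanishes at all
subsequential limits. -/
lemma tendsto_zero_of_forall_subseq {α : Type*} [TopologicalSpace α] [FirstCountableTopology α]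
    {K : Set α} (hK : IsCompact K) {u : ℕ → α} (hu : ∀ t, u t ∈ K) {h : α → ℝ} (hh : Continuous h)
    (hlim : ∀ (φ : ℕ → ℕ) (a : α), Tendsto φ atTop atTop → Tendsto (u ∘ φ) atTop (𝓝 a) → h a = 0) :
    Tendsto (fun t => h (u t)) atTop (𝓝 0) := by
  refine tendsto_of_subseq_tendsto fun ns hns => ?_
  obtain ⟨a, -, φ, hφ, ha⟩ := hK.tendsto_subseq (x := u ∘ ns) fun t => hu _
  refine ⟨φ, ?_⟩
  have h0 := hlim (ns ∘ φ) a (hns.comp hφ.tendsto_atTop) ha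
  rw [← h0]
  exact (hh.tendsto a).comp ha

lemma tendsto_zero_of_const_mul_sq {g : ℕ → ℝ} {k : ℝ} (hk : 0 < k) (hg : ∀ t, 0 ≤ g t)
    (h : Tendsto (fun t => k * g t ^ 2) atTop (𝓝 0)) : Tendsto g atTop (𝓝 0) := by
  have h1 : Tendsto (fun t => g t ^ 2) atTop (𝓝 0) := by
    have := h.const_mul k⁻¹
    rw [mul_zero] at this
    exact this.congr fun t => by field_simp
  have h2 := h1.sqrt
  rw [Real.sqrt_zero] at h2
  exact h2.congr fun t => Real.sqrt_sq (hg t)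

end Sequences

namespace BoxProblem

variable {n m : ℕ} {Q : BoxProblem n m}

lemma IsRegular.exists_minimizer_proxLagrangian {L γ : ℝ} (hQ : Q.IsRegular L γ)
    (hne : Q.box.Nonempty) (Γ p : ℝ) (z : EuclideanSpace ℝ (Fin n))
    (y : EuclideanSpace ℝ (Fin m)) :
    ∃ w, IsMinOn (fun u => Q.proxLagrangian Γ p u z y) Q.box w ∧
      Q.IsProxStationary p z w (y + Γ • Q.residual w) := by
  obtain ⟨w, hw, hws⟩ := hQ.exists_isMinOn hne Γ p z y 0
  refine ⟨w, ?_, by simpa using hws⟩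
  simpa [proxLagrangian, augLagrangian, add_assoc] using hw

/-! ### Convergence of the iterates -/

lemma IsProximalALMRun.mem_box {Γ p c α β : ℝ} {x : ℕ → EuclideanSpace ℝ (Fin n)}
    {y : ℕ → EuclideanSpace ℝ (Fin m)} {z : ℕ → EuclideanSpace ℝ (Fin n)}
    (h : Q.IsProximalALMRun Γ p c α β x y z) (hbox : ∀ i, Q.lower i < Q.upper i)
    (hβ : 0 ≤ β) (hβ1 : β ≤ 1) (t : ℕ) : x t ∈ Q.box ∧ z t ∈ Q.box := by
  have hx : ∀ t, x t ∈ Q.box := by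
    rintro (_ | t)
    · exact h.x_zero
    · rw [h.x_step]; exact proj_mem_box hbox _
  refine ⟨hx t, ?_⟩
  induction t with
  | zero => exact h.z_zero
  | succ t ih =>
    rw [h.z_step]
    exact convex_box.add_smul_sub_mem ih (hx _) ⟨hβ, hβ1⟩

/-- The multipliers move in the range of `A`. -/
lemma IsProximalALMRun.exists_sub_eq_map {Γ p c α β : ℝ} {x : ℕ → EuclideanSpace ℝ (Fin n)}
    {y : ℕ → EuclideanSpace ℝ (Fin m)} {z : ℕ → EuclideanSpace ℝ (Fin n)}
    (h : Q.IsProximalALMRun Γ p c α β x y z) {x₀ : EuclideanSpace ℝ (Fin n)}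
    (hx₀ : Q.residual x₀ = 0) (t : ℕ) : ∃ u, y t - y 0 = Q.A.toEuclideanLin u := by
  induction t with
  | zero => exact ⟨0, by simp⟩
  | succ t ih =>
    obtain ⟨u, hu⟩ := ih
    refine ⟨u + α • (x t - x₀), ?_⟩
    rw [map_add, map_smul, ← residual_sub, hx₀, sub_zero, ← hu, h.y_step]
    abel

/-- The asymptotic behaviour of the method for small stepsizes: the dual iterates are bounded, and
primal steps, residuals and distances to the proximal centers tend to zero. -/
theorem IsRegular.exists_stepsizes {L γ : ℝ} (hQ : Q.IsRegular L γ)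
    (hbox : ∀ i, Q.lower i < Q.upper i) {δ : ℝ} (hδ : 0 < δ)
    (hball : ∀ v, ‖Q.A.toEuclideanLin v‖ ≤ δ → ∃ x ∈ Q.box, Q.residual x = Q.A.toEuclideanLin v)
    {Γ p c : ℝ} (hL : 0 ≤ L) (hΓ : 0 ≤ Γ) (hp : 0 < p) (hpγ : 0 < p + γ) (hc : 0 < c)
    (hcL : c * (L + p + Γ * Q.sigma ^ 2) ≤ 1) :
    ∃ α₀ : ℝ, 0 < α₀ ∧ ∀ α : ℝ, 0 < α → α < α₀ →
    ∃ β₀ : ℝ, 0 < β₀ ∧ β₀ ≤ 1 ∧ ∀ β : ℝ, 0 < β → β < β₀ →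
    ∀ (x : ℕ → EuclideanSpace ℝ (Fin n)) (y : ℕ → EuclideanSpace ℝ (Fin m))
      (z : ℕ → EuclideanSpace ℝ (Fin n)), Q.IsProximalALMRun Γ p c α β x y z →
      (∃ B : ℝ, ∀ t, ‖y t‖ ≤ B) ∧
      Tendsto (fun t => ‖x (t + 1) - x t‖) atTop (𝓝 0) ∧
      Tendsto (fun t => ‖Q.residual (x t)‖) atTop (𝓝 0) ∧
      Tendsto (fun t => ‖x (t + 1) - z t‖) atTop (𝓝 0) := by
  obtain ⟨x₀, hx₀, hx₀r⟩ := hball 0 (by simpa using hδ.le)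
  rw [map_zero] at hx₀r
  obtain ⟨κ, hκ0, hκ⟩ := hQ.exists_dual_error_bound hδ hball hL hp.le hpγ
  set ρ := (1 + c * (L + p + Γ * Q.sigma ^ 2)) / (c * (p + γ)) with hρ
  have hρ0 : 0 ≤ ρ := by positivity
  have hσ := sigma_nonneg (Q := Q)
  -- the stepsizes for which the error terms use at most half of the decrease of the potential
  refine ⟨1 / (4 * c * ((Q.sigma * ρ) ^ 2 + 1)), by positivity, fun α hα hα' => ?_⟩
  have hαs : α * (Q.sigma * ρ) ^ 2 ≤ 1 / (4 * c) := by
    rw [lt_div_iff₀ (by positivity)] at hα'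
    rw [le_div_iff₀ (by positivity)]
    have : 0 < α * (4 * c) := by positivity
    linarith
  refine ⟨min 1 (min ((p + γ) / (16 * p)) (α / (16 * p * κ ^ 2 + 1))), by positivity,
    min_le_left _ _, fun β hβ hβ' x y z hrun => ?_⟩
  obtain ⟨hβ1, hβ2, hβ3⟩ : β < 1 ∧ β < (p + γ) / (16 * p) ∧ β < α / (16 * p * κ ^ 2 + 1) := by
    simpa [lt_min_iff] using hβ'
  have hβp : 16 * p * β ≤ p + γ := by
    rw [lt_div_iff₀ (by positivity)] at hβ2
    linarith
  have hβκ : 16 * p * κ ^ 2 * β ≤ α := by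
    rw [lt_div_iff₀ (by positivity)] at hβ3
    linarith
  have hxb : ∀ t, x t ∈ Q.box := fun t => (hrun.mem_box hbox hβ.le hβ1.le t).1
  have hzb : ∀ t, z t ∈ Q.box := fun t => (hrun.mem_box hbox hβ.le hβ1.le t).2
  have hxs : ∀ t, x (t + 1)
      = Q.proj (x t - c • Q.proxField p (z t) (x t) (y (t + 1) + Γ • Q.residual (x t))) :=
    fun t => by rw [hrun.x_step, hQ.gradient_proxLagrangian Γ p (hxb t)]
  choose W hWmin hWs using fun z y => hQ.exists_minimizer_proxLagrangian ⟨x₀, hx₀⟩ Γ p z y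
  choose S Y hSs hSr hSmin using fun z => hQ.exists_constrained_minimizer hδ hball hpγ z
  -- the potential function
  set φ : ℕ → ℝ := fun t => Q.proxLagrangian Γ p (x t) (z t) (y t)
    - 2 * Q.proxLagrangian Γ p (W (z t) (y t)) (z t) (y t)
    + 2 * (Q.f (S (z t)) + p / 2 * ‖S (z t) - z t‖ ^ 2) with hφ
  set g : ℕ → ℝ := fun t => 1 / (4 * c) * ‖x (t + 1) - x t‖ ^ 2
    + α / 2 * ‖Q.residual (W (z t) (y (t + 1)))‖ ^ 2 + p * β / 4 * ‖x (t + 1) - z t‖ ^ 2 with hg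
  have hstep : ∀ t, φ (t + 1) + g t ≤ φ t := fun t =>
    hQ.potential_decrease hbox hL hΓ hp hpγ hc hcL hρ hα hαs hβ hβ1.le hβp hβκ (hxb t)
      (hrun.y_step t) (hxs t) (hrun.z_step t) (hWmin _ _) (hWs _ _) (hWs _ _) (hWmin _ _)
      (hSmin _ _ (hSs _).1 (hSr _)) (hκ _ _ _ _ _ (hWs _ _) (hSs _) (hSr _))
  obtain ⟨xm, -, hxm⟩ := isCompact_box.exists_isMinOn ⟨x₀, hx₀⟩ hQ.continuousOn_f
  have hfS : ∀ t, Q.f xm ≤ Q.f (S (z t)) + p / 2 * ‖S (z t) - z t‖ ^ 2 := fun t => by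
    have h1 : Q.f xm ≤ Q.f (S (z t)) := hxm (hSs _).1
    have h2 : 0 ≤ p / 2 * ‖S (z t) - z t‖ ^ 2 := by positivity
    linarith
  have hdx : ∀ t, Q.proxLagrangian Γ p (W (z t) (y t)) (z t) (y t)
      ≤ Q.proxLagrangian Γ p (x t) (z t) (y t) := fun t => hWmin _ _ (hxb t)
  have hdS : ∀ t, Q.proxLagrangian Γ p (W (z t) (y t)) (z t) (y t)
      ≤ Q.f (S (z t)) + p / 2 * ‖S (z t) - z t‖ ^ 2 := fun t => by
    rw [← proxLagrangian_of_residual_eq_zero Γ p (hSr _) _ (y t)]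
    exact hWmin _ _ (hSs _).1
  have hφlow : ∀ t, Q.f xm ≤ φ t := fun t => by
    rw [hφ]; linarith [hfS t, hdx t, hdS t]
  have hg0 : ∀ t, 0 ≤ g t := fun t => by rw [hg]; positivity
  have hgt := tendsto_zero_of_add_le hφlow hg0 hstep
  have hx1 : Tendsto (fun t => ‖x (t + 1) - x t‖) atTop (𝓝 0) :=
    tendsto_zero_of_const_mul_sq (k := 1 / (4 * c)) (by positivity) (fun t => norm_nonneg _)
      (squeeze_zero (fun t => by positivity)
        (fun t => (le_add_of_nonneg_right (by positivity)).trans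
          (le_add_of_nonneg_right (by positivity))) hgt)
  have hr1 : Tendsto (fun t => ‖Q.residual (W (z t) (y (t + 1)))‖) atTop (𝓝 0) :=
    tendsto_zero_of_const_mul_sq (k := α / 2) (by positivity) (fun t => norm_nonneg _)
      (squeeze_zero (fun t => by positivity)
        (fun t => (le_add_of_nonneg_left (by positivity)).trans
          (le_add_of_nonneg_right (by positivity))) hgt)
  have hz1 : Tendsto (fun t => ‖x (t + 1) - z t‖) atTop (𝓝 0) :=
    tendsto_zero_of_const_mul_sq (k := p * β / 4) (by positivity) (fun t => norm_nonneg _)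
      (squeeze_zero (fun t => by positivity)
        (fun t => le_add_of_nonneg_left (by positivity)) hgt)
  refine ⟨?_, hx1, ?_, hz1⟩
  · -- the dual values stay bounded from below, which bounds the multipliers
    have hφ0 : ∀ t, φ t ≤ φ 0 := fun t =>
      antitone_nat_of_succ_le (fun t => by linarith [hstep t, hg0 t]) (Nat.zero_le t)
    obtain ⟨D, hD0, hD⟩ := exists_norm_sub_le_of_mem_box (Q := Q)
    obtain ⟨F, hF⟩ := isCompact_box.exists_bound_of_continuousOn hQ.continuousOn_f
    obtain ⟨R, hR⟩ := isCompact_box.exists_bound_of_continuousOn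
      (continuous_residual (Q := Q)).continuousOn
    set C : ℝ := φ 0 - 2 * Q.f xm + F + Γ / 2 * R ^ 2 + p / 2 * D ^ 2 + ‖y 0‖ * R with hC
    refine ⟨2 * C / δ + ‖y 0‖, fun t => ?_⟩
    obtain ⟨u, hu⟩ := hrun.exists_sub_eq_map hx₀r t
    have hbd : ‖y t - y 0‖ ≤ 2 * C / δ := by
      rw [hu]
      refine norm_le_of_forall_le_inner hδ hball (v := 0) (by simpa using (half_pos hδ).le)
        fun w hw => ?_
      rw [← hu, map_zero, sub_zero, inner_sub_left]
      have h1 : Q.proxLagrangian Γ p (W (z t) (y t)) (z t) (y t)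
          ≤ Q.proxLagrangian Γ p w (z t) (y t) := hWmin _ _ hw
      have h2 : 2 * Q.f xm - φ 0 ≤ Q.proxLagrangian Γ p (W (z t) (y t)) (z t) (y t) := by
        have h3 := hφ0 t
        have h4 : φ t = Q.proxLagrangian Γ p (x t) (z t) (y t)
          - 2 * Q.proxLagrangian Γ p (W (z t) (y t)) (z t) (y t)
          + 2 * (Q.f (S (z t)) + p / 2 * ‖S (z t) - z t‖ ^ 2) := rfl
        linarith [hfS t, hdx t]
      have h3 : Q.proxLagrangian Γ p w (z t) (y t) = Q.f w + ⟪y t, Q.residual w⟫_ℝ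
          + Γ / 2 * ‖Q.residual w‖ ^ 2 + p / 2 * ‖w - z t‖ ^ 2 := rfl
      have h4 : Q.f w ≤ F := (le_abs_self _).trans (hF w hw)
      have h5 : Γ / 2 * ‖Q.residual w‖ ^ 2 ≤ Γ / 2 * R ^ 2 := by
        gcongr; exact hR w hw
      have h6 : p / 2 * ‖w - z t‖ ^ 2 ≤ p / 2 * D ^ 2 := by
        gcongr; exact hD _ hw _ (hzb t)
      have h7 : ⟪y 0, Q.residual w⟫_ℝ ≤ ‖y 0‖ * R :=
        (real_inner_le_norm _ _).trans (mul_le_mul_of_nonneg_left (hR w hw) (norm_nonneg _))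
      linarith
    calc ‖y t‖ = ‖(y t - y 0) + y 0‖ := by rw [sub_add_cancel]
      _ ≤ _ := (norm_add_le _ _).trans (by gcongr)
  · have hbd : ∀ t, ‖Q.residual (x t)‖
        ≤ Q.sigma * (ρ * ‖x (t + 1) - x t‖) + ‖Q.residual (W (z t) (y (t + 1)))‖ := fun t => by
      have h1 : ‖Q.residual (x t) - Q.residual (W (z t) (y (t + 1)))‖
          ≤ Q.sigma * (ρ * ‖x (t + 1) - x t‖) := by
        rw [residual_sub]
        exact (norm_map_le _).trans (mul_le_mul_of_nonneg_left
          (hQ.norm_sub_le_norm_proj_sub hbox hL hΓ hp.le hc hpγ (hxb t) (hxs t) (hWs _ _)) hσ)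
      calc ‖Q.residual (x t)‖ = ‖(Q.residual (x t) - Q.residual (W (z t) (y (t + 1))))
            + Q.residual (W (z t) (y (t + 1)))‖ := by rw [sub_add_cancel]
        _ ≤ _ := (norm_add_le _ _).trans (by gcongr)
    refine squeeze_zero (fun t => norm_nonneg _) hbd ?_
    simpa using ((hx1.const_mul ρ).const_mul Q.sigma).add hr1

/-- Fixed points of the projected gradient step are solutions of the KKT system. -/
lemma exists_isKKT_of_eq_proj (hbox : ∀ i, Q.lower i < Q.upper i) {c : ℝ} (hc : 0 < c)
    {x : EuclideanSpace ℝ (Fin n)} {y : EuclideanSpace ℝ (Fin m)} (hr : Q.residual x = 0)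
    (hx : x = Q.proj (x - c • (∇ Q.f x + Q.A.transpose.toEuclideanLin y))) :
    ∃ μ ν, Q.IsKKT x y μ ν := by
  have hxb : x ∈ Q.box := hx ▸ proj_mem_box hbox _
  set g := ∇ Q.f x + Q.A.transpose.toEuclideanLin y with hg
  have hvi : ∀ w ∈ Q.box, 0 ≤ ⟪g, w - x⟫_ℝ := fun w hw => by
    have h1 := inner_proj_sub_nonneg hbox (x - c • g) hw
    rw [← hx, sub_sub_cancel, real_inner_smul_left] at h1
    exact nonneg_of_mul_nonneg_right h1 hc
  rw [forall_inner_sub_nonneg_iff hxb] at hvi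
  refine ⟨WithLp.toLp 2 fun i => max (g i) 0, WithLp.toLp 2 fun i => max (-g i) 0,
    ⟨?_, sub_eq_zero.mp hr, hxb, fun i => le_max_right _ _, fun i => le_max_right _ _,
      fun i => ?_, fun i => ?_⟩⟩
  · rw [← hg]
    ext i
    simp only [PiLp.add_apply, PiLp.sub_apply, PiLp.zero_apply]
    rcases le_total (g i) 0 with h | h
    · rw [max_eq_right h, max_eq_left (by linarith)]; ring
    · rw [max_eq_left h, max_eq_right (by linarith)]; ring
  · rcases (hxb i).1.eq_or_lt with h | h
    · rw [h, sub_self, mul_zero]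
    · simp only [max_eq_right ((hvi i).1 h), zero_mul]
  · rcases (hxb i).2.eq_or_lt with h | h
    · rw [h, sub_self, mul_zero]
    · simp only [max_eq_right (neg_nonpos.mpr ((hvi i).2 h)), zero_mul]

/-- Subsequential limits of the iterates are primal-dual stationary. -/
lemma IsRegular.exists_isKKT_of_tendsto {L γ : ℝ} (hQ : Q.IsRegular L γ)
    (hbox : ∀ i, Q.lower i < Q.upper i) {Γ p c α β : ℝ} (hc : 0 < c) (hβ : 0 ≤ β) (hβ1 : β ≤ 1)
    {x : ℕ → EuclideanSpace ℝ (Fin n)} {y : ℕ → EuclideanSpace ℝ (Fin m)}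
    {z : ℕ → EuclideanSpace ℝ (Fin n)} (hrun : Q.IsProximalALMRun Γ p c α β x y z)
    (hx1 : Tendsto (fun t => ‖x (t + 1) - x t‖) atTop (𝓝 0))
    (hr1 : Tendsto (fun t => ‖Q.residual (x t)‖) atTop (𝓝 0))
    (hz1 : Tendsto (fun t => ‖x (t + 1) - z t‖) atTop (𝓝 0))
    {φ : ℕ → ℕ} (hφ : Tendsto φ atTop atTop) {a : EuclideanSpace ℝ (Fin n)}
    {b : EuclideanSpace ℝ (Fin m)} (ha : Tendsto (fun k => x (φ k)) atTop (𝓝 a))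
    (hb : Tendsto (fun k => y (φ k)) atTop (𝓝 b)) : ∃ μ ν, Q.IsKKT a b μ ν := by
  have hxb : ∀ t, x t ∈ Q.box := fun t => (hrun.mem_box hbox hβ hβ1 t).1
  have hab : a ∈ Q.box :=
    isCompact_box.isClosed.mem_of_tendsto ha (Eventually.of_forall fun k => hxb _)
  have hr2 : Tendsto (fun k => Q.residual (x (φ k))) atTop (𝓝 0) :=
    (tendsto_zero_iff_norm_tendsto_zero.mpr hr1).comp hφ
  have hra : Q.residual a = 0 :=
    tendsto_nhds_unique ((continuous_residual.tendsto a).comp ha) hr2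
  have hxs : Tendsto (fun k => x (φ k + 1)) atTop (𝓝 a) := by
    have := ((tendsto_zero_iff_norm_tendsto_zero.mpr hx1).comp hφ).add ha
    simpa using this
  have hz : Tendsto (fun k => z (φ k)) atTop (𝓝 a) := by
    have := hxs.sub ((tendsto_zero_iff_norm_tendsto_zero.mpr hz1).comp hφ)
    simpa using this
  have hys : Tendsto (fun k => y (φ k + 1)) atTop (𝓝 b) := by
    have := hb.add (hr2.const_smul α)
    simpa [hrun.y_step] using this
  have hF : Tendsto (fun k => Q.proxField p (z (φ k)) (x (φ k))
      (y (φ k + 1) + Γ • Q.residual (x (φ k)))) atTop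
      (𝓝 (∇ Q.f a + p • (a - a) + Q.A.transpose.toEuclideanLin (b + Γ • (0 : EuclideanSpace ℝ _)))) :=
    ((hQ.tendsto_gradient (fun k => hxb _) hab ha).add ((ha.sub hz).const_smul p)).add
      ((continuous_transpose.tendsto _).comp (hys.add (hr2.const_smul Γ)))
  rw [sub_self, smul_zero, smul_zero, add_zero, add_zero] at hF
  refine exists_isKKT_of_eq_proj hbox hc hra (tendsto_nhds_unique hxs ?_)
  have hstep : ∀ k, x (φ k + 1) = Q.proj (x (φ k) - c • Q.proxField p (z (φ k)) (x (φ k))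
      (y (φ k + 1) + Γ • Q.residual (x (φ k)))) := fun k => by
    rw [hrun.x_step, hQ.gradient_proxLagrangian Γ p (hxb _)]
  simp only [hstep]
  exact (continuous_proj.tendsto _).comp (ha.sub (hF.const_smul c))

end BoxProblem

theorem theorem1 {n m : ℕ} (Q : BoxProblem n m)
    (hbox : ∀ i, Q.lower i < Q.upper i)
    -- the origin is in the relative interior of `AP - b`
    (hint : (0 : EuclideanSpace ℝ (Fin m)) ∈ intrinsicInterior ℝ (Q.residual '' Q.box))
    (hsc : Q.StrictComplementarity)
    -- `f` is differentiable on `P` with `L`-Lipschitz gradient on `P`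
    (hdiff : ∀ x ∈ Q.box, DifferentiableAt ℝ Q.f x)
    (L : ℝ) (hL : 0 < L)
    (hlip : ∀ x ∈ Q.box, ∀ x' ∈ Q.box, ‖∇ Q.f x - ∇ Q.f x'‖ ≤ L * ‖x - x'‖)
    -- the (possibly negative) monotonicity constant of the gradient on `P`
    (γ : ℝ)
    (hγ : ∀ x ∈ Q.box, ∀ x' ∈ Q.box, γ * ‖x - x'‖ ^ 2 ≤ ⟪∇ Q.f x - ∇ Q.f x', x - x'⟫_ℝ)
    -- the parameters of the method
    (Γ p c : ℝ) (hΓ : 0 < Γ) (hp : 0 < p) (hpγ : -γ < p)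
    (hc : 0 < c) (hcL : c < 1 / (L + p + Γ * Q.sigma ^ 2)) :
    ∃ α₀ : ℝ, 0 < α₀ ∧ ∀ α : ℝ, 0 < α → α < α₀ →
    ∃ β₀ : ℝ, 0 < β₀ ∧ β₀ ≤ 1 ∧ ∀ β : ℝ, 0 < β → β < β₀ →
    ∀ (x : ℕ → EuclideanSpace ℝ (Fin n)) (y : ℕ → EuclideanSpace ℝ (Fin m))
      (z : ℕ → EuclideanSpace ℝ (Fin n)), Q.IsProximalALMRun Γ p c α β x y z →
      (∃ B : ℝ, ∀ t, ‖y t‖ ≤ B) ∧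
      Tendsto (fun t => ‖x (t + 1) - x t‖) atTop (𝓝 0) ∧
      Q.stationarySet.Nonempty ∧
      Tendsto (fun t => Metric.infDist (x t) Q.stationarySet) atTop (𝓝 0) ∧
      Tendsto (fun t => Metric.infDist (z t) Q.stationarySet) atTop (𝓝 0) ∧
      Tendsto (fun t => Metric.infDist (WithLp.toLp 2 (x t, y t)) Q.primalDualSet)
        atTop (𝓝 0) ∧
      ∀ w : WithLp 2 (EuclideanSpace ℝ (Fin n) × EuclideanSpace ℝ (Fin m)),
        MapClusterPt w atTop (fun t => WithLp.toLp 2 (x t, y t)) → w ∈ Q.primalDualSet := by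
  have hQ : Q.IsRegular L γ := ⟨hdiff, hlip, hγ⟩
  obtain ⟨δ, hδ, hball⟩ := BoxProblem.exists_residual_eq_of_mem_intrinsicInterior hbox hint
  have hcL' : c * (L + p + Γ * Q.sigma ^ 2) ≤ 1 := by
    rw [lt_div_iff₀ (by positivity)] at hcL
    exact hcL.le
  obtain ⟨α₀, hα₀, h⟩ := hQ.exists_stepsizes hbox hδ hball hL.le hΓ.le hp (by linarith) hc hcL'
  refine ⟨α₀, hα₀, fun α hα hα' => ?_⟩
  obtain ⟨β₀, hβ₀, hβ₀1, h⟩ := h α hα hα'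
  refine ⟨β₀, hβ₀, hβ₀1, fun β hβ hβ' x y z hrun => ?_⟩
  obtain ⟨⟨B, hB⟩, hx1, hr1, hz1⟩ := h β hβ hβ' x y z hrun
  have hlim : ∀ (φ : ℕ → ℕ) (a : EuclideanSpace ℝ (Fin n) × EuclideanSpace ℝ (Fin m)),
      Tendsto φ atTop atTop → Tendsto ((fun t => (x t, y t)) ∘ φ) atTop (𝓝 a) →
      ∃ μ ν, Q.IsKKT a.1 a.2 μ ν := fun φ a hφ ha =>
    hQ.exists_isKKT_of_tendsto hbox hc hβ.le (hβ'.le.trans hβ₀1) hrun hx1 hr1 hz1 hφ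
      ((continuous_fst.tendsto _).comp ha) ((continuous_snd.tendsto _).comp ha)
  have hcomp : IsCompact (Q.box ×ˢ Metric.closedBall (0 : EuclideanSpace ℝ (Fin m)) B) :=
    BoxProblem.isCompact_box.prod (isCompact_closedBall _ _)
  have hmem : ∀ t, (x t, y t) ∈ Q.box ×ˢ Metric.closedBall (0 : EuclideanSpace ℝ (Fin m)) B :=
    fun t => ⟨(hrun.mem_box hbox hβ.le (hβ'.le.trans hβ₀1) t).1, by simpa using hB t⟩
  have hdist : Tendsto (fun t => Metric.infDist (x t) Q.stationarySet) atTop (𝓝 0) :=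
    tendsto_zero_of_forall_subseq hcomp hmem
      (h := fun a => Metric.infDist a.1 Q.stationarySet)
      ((Metric.continuous_infDist_pt _).comp continuous_fst) fun φ a hφ ha =>
        Metric.infDist_zero_of_mem ⟨a.2, hlim φ a hφ ha⟩
  refine ⟨⟨B, hB⟩, hx1, ?_, hdist, ?_, ?_, fun w hw => ?_⟩
  · obtain ⟨a, -, φ, hφ, ha⟩ := hcomp.tendsto_subseq hmem
    exact ⟨a.1, a.2, hlim φ a hφ.tendsto_atTop ha⟩
  · have hbd : ∀ t, Metric.infDist (z t) Q.stationarySet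
        ≤ Metric.infDist (x t) Q.stationarySet + (‖x (t + 1) - x t‖ + ‖x (t + 1) - z t‖) := by
      intro t
      have h1 := Metric.infDist_le_infDist_add_dist (s := Q.stationarySet) (x := z t) (y := x t)
      have h2 := dist_triangle_left (z t) (x t) (x (t + 1))
      simp only [dist_eq_norm] at h1 h2
      linarith
    exact squeeze_zero (fun t => Metric.infDist_nonneg) hbd
      (by simpa using hdist.add (hx1.add hz1))
  · exact tendsto_zero_of_forall_subseq hcomp hmem
      (h := fun a => Metric.infDist (WithLp.toLp 2 a) Q.primalDualSet)
      ((Metric.continuous_infDist_pt _).comp (WithLp.prod_continuous_toLp 2 _ _))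
      fun φ a hφ ha => Metric.infDist_zero_of_mem (hlim φ a hφ ha)
  · obtain ⟨φ, hφ, hφw⟩ := hw.tendsto_subseq
    exact hlim φ w.ofLp hφ.tendsto_atTop
      (((WithLp.prod_continuous_ofLp 2 _ _).tendsto w).comp hφw)
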